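/- There is an absolute constant $c>0$ such that the following holds for all integers $d,n,p\ge 0$, all $\gamma>0$, all $\theta\in\mathbb{R}^d$ and all $W\in\mathbb{R}^{p\times d}$ with $W^\top W=p\gamma I_d$, provided $n\ge d$ and $p\ge\max(17n,1/\gamma)$. Let $z_1,\dots,z_n\sim\mathcal N(0,I_d)$, $u_1,\dots,u_n\sim\mathcal N(0,I_p)$ and a Haar-distributed random orthogonal $p\times p$ matrix $O$ be mutually independent. Let $X_A\in\mathbb{R}^{n\times p}$ have rows $x_i=Wz_i+u_i$, let $y\in\mathbb{R}^n$ have entries $y_i=z_i^\top\theta$, and let $X_B=X_AO^\top$. Task A has data $(X_A,y)$ and task B has data $(X_B,y)$. Put $$\hat\beta_A=\arg\min\Bigl\{\tfrac12\|\hat\beta\|^2 : y=X_A\hat\beta\Bigr\},\qquad \hat\beta_{BA}=\arg\min\Bigl\{\tfrac12\|\hat\beta-\hat\beta_A\|^2 : y=X_B\hat\beta\Bigr\},$$ and, for $\hat\beta\in\mathbb{R}^p$, let $$R(f_{\hat\beta})=\mathbb{E}\bigl(x^\top\hat\beta-z^\top\theta\bigr)^2,\qquad x=Wz+u,\quad z\sim\mathcal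 N(0,I_d),\ u\sim\mathcal N(0,I_p)\text{ independent},$$ be the risk on task A of the estimator $f_{\hat\beta}:x\mapsto x^\top\hat\beta$ (for random $\hat\beta$ it is evaluated at the realized value). Then, with probability at least $1-10e^{-cd}$, both minimizers exist (they are then unique) and $$R(f_{\hat\beta_{BA}})-R(f_{\hat\beta_A})\le\left(66\sqrt{\frac np}+\frac{12}{p\gamma}\right)\|\theta\|^2 .$$ -/

import Mathlib

open MeasureTheory ProbabilityTheory
open scoped Matrix

namespace LatentRegression

/-- The Borel `σ`-algebra of the orthogonal group `O(p)`, a topological subspace of the real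
`p × p` matrices. -/
instance instMeasurableSpaceOrthogonalGroup (p : ℕ) :
    MeasurableSpace (Matrix.orthogonalGroup (Fin p) ℝ) :=
  borel _

instance instBorelSpaceOrthogonalGroup (p : ℕ) :
    BorelSpace (Matrix.orthogonalGroup (Fin p) ℝ) :=
  ⟨rfl⟩

/-- The observed features `x = W z + u` of an example with latent features `z` and noise `u`. -/
noncomputable def observed {p d : ℕ} (W : Matrix (Fin p) (Fin d) ℝ)
    (z : EuclideanSpace ℝ (Fin d)) (u : EuclideanSpace ℝ (Fin p)) : EuclideanSpace ℝ (Fin p) :=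
  WithLp.toLp 2 (W *ᵥ z.ofLp) + u

/-- The noiseless response `y = zᵀ θ` of an example with latent features `z`. -/
noncomputable def response {d : ℕ} (θ z : EuclideanSpace ℝ (Fin d)) : ℝ :=
  inner ℝ z θ

/-- The data matrix of task A, whose `i`-th row is `W zᵢ + uᵢ`. -/
noncomputable def dataA {n p d : ℕ} (W : Matrix (Fin p) (Fin d) ℝ)
    (Z : Fin n → EuclideanSpace ℝ (Fin d)) (U : Fin n → EuclideanSpace ℝ (Fin p)) :
    Matrix (Fin n) (Fin p) ℝ :=
  Matrix.of fun i => (observed W (Z i) (U i)).ofLp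

/-- The data matrix `X_B = X_A Oᵀ` of task B. -/
noncomputable def dataB {n p d : ℕ} (W : Matrix (Fin p) (Fin d) ℝ)
    (Z : Fin n → EuclideanSpace ℝ (Fin d)) (U : Fin n → EuclideanSpace ℝ (Fin p))
    (O : Matrix.orthogonalGroup (Fin p) ℝ) : Matrix (Fin n) (Fin p) ℝ :=
  dataA W Z U * (O : Matrix (Fin p) (Fin p) ℝ)ᵀ

/-- The vector of responses, common to both tasks. -/
noncomputable def responses {n d : ℕ} (θ : EuclideanSpace ℝ (Fin d))
    (Z : Fin n → EuclideanSpace ℝ (Fin d)) : Fin n → ℝ :=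
  fun i => response θ (Z i)

/-- `b` solves `argmin ½‖b - b₀‖²` subject to `y = X b`: it is an interpolator of the data
`(X, y)` closest to the initialization `b₀`. -/
def IsClosestInterpolator {n p : ℕ} (X : Matrix (Fin n) (Fin p) ℝ) (y : Fin n → ℝ)
    (b₀ b : EuclideanSpace ℝ (Fin p)) : Prop :=
  y = X *ᵥ b.ofLp ∧
    IsMinOn (fun b' : EuclideanSpace ℝ (Fin p) => 1 / 2 * ‖b' - b₀‖ ^ 2)
      {b' | y = X *ᵥ b'.ofLp} b

/-- The optimization problem has at most one solution. -/
theorem IsClosestInterpolator.unique {n p : ℕ} {X : Matrix (Fin n) (Fin p) ℝ} {y : Fin n → ℝ}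
    {b₀ b b' : EuclideanSpace ℝ (Fin p)} (h : IsClosestInterpolator X y b₀ b)
    (h' : IsClosestInterpolator X y b₀ b') : b = b' := by
  have hm : y = X *ᵥ ((1 / 2 : ℝ) • (b + b')).ofLp := by
    rw [WithLp.ofLp_smul, WithLp.ofLp_add, Matrix.mulVec_smul, Matrix.mulVec_add, ← h.1, ← h'.1]
    ext i
    simp only [Pi.smul_apply, Pi.add_apply, smul_eq_mul]
    ring
  have h1 := isMinOn_iff.1 h.2 _ hm
  have h2 := isMinOn_iff.1 h'.2 _ hm
  have hp := parallelogram_law_with_norm ℝ (b - b₀) (b' - b₀)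
  have e1 : b - b₀ + (b' - b₀) = (2 : ℝ) • ((1 / 2 : ℝ) • (b + b') - b₀) := by module
  have e2 : b - b₀ - (b' - b₀) = b - b' := by abel
  rw [e1, e2, norm_smul, Real.norm_ofNat] at hp
  have h0 : ‖b - b'‖ = 0 := by
    have := norm_nonneg (b - b')
    nlinarith
  exact sub_eq_zero.1 (norm_eq_zero.1 h0)

/-- The risk on task A of the linear estimator `x ↦ xᵀ b`: the expected squared error on a fresh
example `x = W z + u`, `y = zᵀ θ`, with `z ~ N(0, I_d)` and `u ~ N(0, I_p)` independent. -/
noncomputable def risk {p d : ℕ} (W : Matrix (Fin p) (Fin d) ℝ) (θ : EuclideanSpace ℝ (Fin d))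
    (b : EuclideanSpace ℝ (Fin p)) : ℝ :=
  ∫ e : EuclideanSpace ℝ (Fin d) × EuclideanSpace ℝ (Fin p),
    (inner ℝ (observed W e.1 e.2) b - response θ e.1) ^ 2
      ∂((stdGaussian (EuclideanSpace ℝ (Fin d))).prod (stdGaussian (EuclideanSpace ℝ (Fin p))))

end LatentRegression

/-! Write `L` for `W` as a linear map, `κ = pγ`, so `L*L = κ`, and `Q` for the rotation `O`. The
risk of `b` is `‖L*b − θ‖² + ‖b‖²` (`risk_eq`).

Task A has a cheap interpolator. Let `w = κ⁻¹Lθ` and let `S` be spanned by the noise vectors `uᵢ`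
and `L(θ^⊥)`. The part of `w` orthogonal to `S`, rescaled, is a vector `b` that is blind to the
noise and satisfies `L*b = θ`, hence fits every response. As `dim S` is small against `p`, at least
half of `‖w‖²` survives, so `‖b‖² ≤ 2‖θ‖²/κ`. The minimum-norm interpolator is `β = P_R b`, with `R`
the row space, so `κ‖β‖² ≤ 2‖θ‖²`.

The rows for task B are the rotated rows, and training on it moves `β` to `β + Q P_R(β − Q⁻¹β) = Q(x
− P_R x + β)`, where `x = Q⁻¹β`. The two summands in the bracket are orthogonal, so the squared norm
at most doubles, which costs `O(‖θ‖²/κ)`. The signal part changes by `L*Qβ − L*Q P_R x`. Under Haar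
measure `Qβ` and `Q⁻¹β` point in uniform directions, so their projections onto `range L` and `R`, of
dimension at most `n`, have squared norm at most `(4n/p)‖β‖²`; this costs `O(√(n/p)‖θ‖²)`
(`risk_increase_le`).

The three probabilistic inputs (survival of `w`, the two projections) compare Gaussian projections
by a Chernoff bound (`measure_projection_le`); rotation invariance and Fubini trade a fixed vector
for a Gaussian one (`measure_section_le_of_average`). -/

namespace LatentRegression

/-! ### Chernoff bounds for projections of a Gaussian vector. -/

section GaussianProjections

theorem lintegral_exp_mul_sq_gaussianReal {s : ℝ} (hs : s < 1 / 2) :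
    ∫⁻ x, ENNReal.ofReal (Real.exp (s * x ^ 2)) ∂(gaussianReal 0 1) =
      ENNReal.ofReal (Real.sqrt (1 / (1 - 2 * s))) := by
  have hb : 0 < 1 / 2 - s := by linarith
  have key : ∀ x : ℝ, gaussianPDF 0 1 x * ENNReal.ofReal (Real.exp (s * x ^ 2)) =
      ENNReal.ofReal ((Real.sqrt (2 * Real.pi))⁻¹ * Real.exp (-(1 / 2 - s) * x ^ 2)) := by
    intro x
    rw [gaussianPDF, ← ENNReal.ofReal_mul (gaussianPDFReal_nonneg _ _ _), gaussianPDFReal]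
    congr 1
    rw [mul_assoc, ← Real.exp_add]
    simp only [NNReal.coe_one, mul_one, sub_zero]
    congr 2
    ring
  rw [gaussianReal_of_var_ne_zero _ one_ne_zero,
    lintegral_withDensity_eq_lintegral_mul _ (measurable_gaussianPDF 0 1) (by fun_prop)]
  simp only [Pi.mul_apply, key]
  rw [← ofReal_integral_eq_lintegral_ofReal ((integrable_exp_neg_mul_sq hb).const_mul _)
    (Filter.Eventually.of_forall fun x => by positivity), integral_const_mul, integral_gaussian]
  congr 1
  rw [← Real.sqrt_inv, ← Real.sqrt_mul (by positivity)]
  congr 1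
  have := Real.pi_pos
  have h2 : 1 - 2 * s ≠ 0 := by linarith
  field_simp

/-- After squaring, this is `1 + x ≤ exp x` at `x = -2b / (1 + 2b)`. -/
theorem sqrt_inv_one_add_le {b : ℝ} (hb : 0 ≤ b) :
    Real.sqrt (1 / (1 + 2 * b)) ≤ Real.exp (-(b / (1 + 2 * b))) := by
  rw [Real.sqrt_le_left (Real.exp_pos _).le, ← Real.exp_nat_mul]
  have h := Real.add_one_le_exp (2 * -(b / (1 + 2 * b)))
  have e : 2 * -(b / (1 + 2 * b)) + 1 = 1 / (1 + 2 * b) := by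
    field_simp
    ring
  rw [e] at h
  simpa using h

theorem sqrt_inv_half_le_exp_half : Real.sqrt (1 / (1 - 2 * (1 / 4 : ℝ))) ≤ Real.exp (1 / 2) := by
  rw [Real.sqrt_le_left (Real.exp_pos _).le, ← Real.exp_nat_mul]
  have h := Real.add_one_le_exp (1 : ℝ)
  norm_num at h ⊢
  linarith

variable {E : Type*} [NormedAddCommGroup E] [InnerProductSpace ℝ E] [FiniteDimensional ℝ E]

theorem norm_sq_starProjection_eq_sum (T : Submodule ℝ E) {ι : Type*} [Fintype ι]
    (b : OrthonormalBasis ι ℝ T) (g : E) :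
    ‖T.starProjection g‖ ^ 2 = ∑ i, (inner ℝ (b i : E) g) ^ 2 := by
  rw [Submodule.starProjection_apply, ← Submodule.coe_norm, ← b.sum_sq_norm_inner_right]
  refine Finset.sum_congr rfl fun i _ => ?_
  rw [Real.norm_eq_abs, sq_abs, Submodule.inner_orthogonalProjectionOnto_eq_of_mem_left]

variable [MeasurableSpace E] [BorelSpace E]

theorem lintegral_exp_sum_stdGaussian {ι : Type*} [Fintype ι] (b : OrthonormalBasis ι ℝ E)
    (c : ι → ℝ) (hc : ∀ i, c i < 1 / 2) :
    ∫⁻ g, ENNReal.ofReal (Real.exp (∑ i, c i * (inner ℝ (b i) g) ^ 2)) ∂(stdGaussian E) =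
      ∏ i, ENNReal.ofReal (Real.sqrt (1 / (1 - 2 * c i))) := by
  classical
  rw [stdGaussian_eq_map_pi_orthonormalBasis b, lintegral_map (by fun_prop) (by fun_prop)]
  have : ∀ x : ι → ℝ, ENNReal.ofReal
      (Real.exp (∑ i, c i * (inner ℝ (b i) (∑ j, x j • b j)) ^ 2)) =
      ∏ i, ENNReal.ofReal (Real.exp (c i * (x i) ^ 2)) := by
    intro x
    rw [Real.exp_sum, ENNReal.ofReal_prod_of_nonneg (fun i _ => (Real.exp_pos _).le)]
    refine Finset.prod_congr rfl fun i _ => ?_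
    rw [b.orthonormal.inner_right_fintype]
  simp only [this]
  have hm : ∀ i, Measurable fun t : ℝ => ENNReal.ofReal (Real.exp (c i * t ^ 2)) :=
    fun i => by fun_prop
  rw [lintegral_prod_eq_prod_lintegral_of_indepFun Finset.univ _
    (iIndepFun_pi (μ := fun _ : ι => gaussianReal 0 1)
      (X := fun i t => ENNReal.ofReal (Real.exp (c i * t ^ 2))) fun i => (hm i).aemeasurable)
    (fun i => (hm i).comp (measurable_pi_apply i))]
  refine Finset.prod_congr rfl fun i _ => ?_
  rw [← lintegral_exp_mul_sq_gaussianReal (hc i)]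
  exact (measurePreserving_eval (fun _ : ι => gaussianReal 0 1) i).lintegral_comp (hm i)

/-- Markov's inequality for `exp ((‖P_T g‖² - b‖P_T' g‖²) / 4)`, whose mean factors over an
orthonormal basis adapted to `T` and `T'`: each direction of `T` contributes `√2 ≤ exp (1/2)`, each
direction of `T'` a decaying factor. -/
theorem measure_projection_le (T T' : Submodule ℝ E) (h : T ⟂ T') {b : ℝ} (hb : 0 ≤ b) :
    stdGaussian E {g | b * ‖T'.starProjection g‖ ^ 2 ≤ ‖T.starProjection g‖ ^ 2} ≤
      ENNReal.ofReal (Real.exp (Module.finrank ℝ T / 2 -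
        (b / 4) / (1 + 2 * (b / 4)) * Module.finrank ℝ T')) := by
  set k := Module.finrank ℝ T
  set m := Module.finrank ℝ T'
  have hkm : k + m ≤ Module.finrank ℝ E := by
    have h1 := T.finrank_add_finrank_orthogonal
    have h2 := Submodule.finrank_mono (Submodule.isOrtho_iff_le.1 h.symm)
    omega
  obtain ⟨r, hr⟩ := Nat.exists_eq_add_of_le hkm
  let bT := stdOrthonormalBasis ℝ T
  let bT' := stdOrthonormalBasis ℝ T'
  let v : (Fin k ⊕ Fin m) ⊕ Fin r → E :=
    Sum.elim (Sum.elim (fun i => (bT i : E)) (fun i => (bT' i : E))) 0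
  have hv₀ : Orthonormal ℝ fun i => v (Sum.inl i) := by
    rw [orthonormal_iff_ite]
    have e1 := orthonormal_iff_ite.1 bT.orthonormal
    have e2 := orthonormal_iff_ite.1 bT'.orthonormal
    rintro (i | i) (j | j)
    · simpa [v] using e1 i j
    · simpa [v] using h.inner_eq (bT i).2 (bT' j).2
    · simpa [v] using h.symm.inner_eq (bT' i).2 (bT j).2
    · simpa [v] using e2 i j
  have hv : Orthonormal ℝ ((Set.range (Sum.inl : Fin k ⊕ Fin m → _)).domRestrict v) := by
    convert! hv₀.comp (Equiv.ofInjective _ Sum.inl_injective).symm (Equiv.injective _)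
    ext ⟨_, i, rfl⟩
    simp
  obtain ⟨B, hB⟩ := hv.exists_orthonormalBasis_extension_of_card_eq (by simp [hr])
  -- The `r` directions orthogonal to both subspaces get weight zero and contribute a factor 1.
  let c : (Fin k ⊕ Fin m) ⊕ Fin r → ℝ :=
    Sum.elim (Sum.elim (fun _ => 1 / 4) (fun _ => -(b / 4))) 0
  have hc : ∀ i, c i < 1 / 2 := by
    rintro ((i | i) | i) <;> simp only [c, Sum.elim_inl, Sum.elim_inr, Pi.zero_apply] <;> linarith
  have hsum : ∀ g, ∑ i, c i * (inner ℝ (B i) g) ^ 2 =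
      1 / 4 * (‖T.starProjection g‖ ^ 2 - b * ‖T'.starProjection g‖ ^ 2) := by
    intro g
    have h1 : ∀ i, B (Sum.inl i) = Sum.elim (fun i => (bT i : E)) (fun i => (bT' i : E)) i :=
      fun i => hB _ ⟨i, rfl⟩
    rw [norm_sq_starProjection_eq_sum T bT, norm_sq_starProjection_eq_sum T' bT']
    simp only [Fintype.sum_sum_type, h1, c, Sum.elim_inl, Sum.elim_inr, Pi.zero_apply, zero_mul,
      Finset.sum_const_zero, ← Finset.mul_sum]
    ring
  calc stdGaussian E {g | b * ‖T'.starProjection g‖ ^ 2 ≤ ‖T.starProjection g‖ ^ 2}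
      ≤ stdGaussian E {g | 1 ≤ ENNReal.ofReal (Real.exp (∑ i, c i * (inner ℝ (B i) g) ^ 2))} := by
        refine measure_mono fun g hg => ?_
        simp only [Set.mem_ofPred_eq] at hg ⊢
        rw [ENNReal.one_le_ofReal, Real.one_le_exp_iff, hsum]
        linarith
    _ ≤ ∫⁻ g, ENNReal.ofReal (Real.exp (∑ i, c i * (inner ℝ (B i) g) ^ 2)) ∂(stdGaussian E) := by
        simpa using mul_meas_ge_le_lintegral (μ := stdGaussian E)
          (f := fun g => ENNReal.ofReal (Real.exp (∑ i, c i * (inner ℝ (B i) g) ^ 2)))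
          (by fun_prop) 1
    _ ≤ _ := by
        rw [lintegral_exp_sum_stdGaussian B c hc]
        simp only [Fintype.prod_sum_type, c, Sum.elim_inl, Sum.elim_inr, Pi.zero_apply,
          Finset.prod_const, Finset.card_univ, Fintype.card_fin, mul_zero, sub_zero, div_one,
          Real.sqrt_one, ENNReal.ofReal_one, one_pow, mul_one]
        rw [← ENNReal.ofReal_pow (by positivity), ← ENNReal.ofReal_pow (by positivity),
          ← ENNReal.ofReal_mul (by positivity)]
        refine ENNReal.ofReal_le_ofReal ?_
        have e1 := sqrt_inv_one_add_le (b := b / 4) (by positivity)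
        have r1 : Real.exp (k / 2) = Real.exp (1 / 2) ^ k := by
          rw [← Real.exp_nat_mul]; congr 1; ring
        have r2 : Real.exp (-(b / 4 / (1 + 2 * (b / 4)) * m)) =
            Real.exp (-(b / 4 / (1 + 2 * (b / 4)))) ^ m := by
          rw [← Real.exp_nat_mul]; congr 1; ring
        rw [sub_eq_add_neg (_ / _ : ℝ), Real.exp_add, r1, r2]
        have e3 : 1 - 2 * -(b / 4) = 1 + 2 * (b / 4) := by ring
        rw [e3]
        gcongr
        exact sqrt_inv_half_le_exp_half

end GaussianProjections

/-! ### Replacing a fixed vector by a Gaussian one. -/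

section Averaging

variable {E : Type*} [NormedAddCommGroup E] [InnerProductSpace ℝ E]

theorem span_range_comp_sup (R : E ≃ₗᵢ[ℝ] E) {n : ℕ} (u : Fin n → E) {V : Submodule ℝ E}
    (hV : ∀ v ∈ V, R v = v) :
    Submodule.span ℝ (Set.range fun i => R (u i)) ⊔ V =
      (Submodule.span ℝ (Set.range u) ⊔ V).map (R.toLinearEquiv : E →ₗ[ℝ] E) := by
  rw [Submodule.map_sup, Submodule.map_span, ← Set.range_comp]
  congr 1
  ext v
  simp only [Submodule.mem_map]
  exact ⟨fun hv => ⟨v, hv, hV v hv⟩, by rintro ⟨v, hv, rfl⟩; simpa [hV v hv] using hv⟩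

/-- The reflection swapping `w` with the multiple of `g` of equal norm; its mirror contains
everything orthogonal to both. -/
theorem exists_reflection_smul {w g : E} (hw : w ≠ 0) (hg : g ≠ 0) :
    ∃ (R : E ≃ₗᵢ[ℝ] E) (c : ℝ), 0 < c ∧ R w = c • g ∧
      ∀ v, inner ℝ v w = 0 → inner ℝ v g = 0 → R v = v := by
  have hc : 0 < ‖w‖ / ‖g‖ := div_pos (norm_pos_iff.2 hw) (norm_pos_iff.2 hg)
  refine ⟨Submodule.reflection (ℝ ∙ (w - (‖w‖ / ‖g‖) • g))ᗮ, ‖w‖ / ‖g‖, hc,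
    Submodule.reflection_sub ?_, fun v h1 h2 => ?_⟩
  · rw [norm_smul, Real.norm_of_nonneg hc.le, div_mul_cancel₀ _ (norm_ne_zero_iff.2 hg)]
  · rw [Submodule.reflection_eq_self_iff, Submodule.mem_orthogonal_singleton_iff_inner_left,
      inner_sub_right, inner_smul_right, h1, h2]
    simp

variable [FiniteDimensional ℝ E]

theorem norm_sub_starProjection_sq (S : Submodule ℝ E) (x : E) :
    ‖x - S.starProjection x‖ ^ 2 = ‖x‖ ^ 2 - inner ℝ (S.starProjection x) x := by
  have h : inner ℝ (S.starProjection x) (x - S.starProjection x) = 0 :=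
    S.sub_starProjection_mem_orthogonal x _ (S.starProjection_apply_mem x)
  rw [← real_inner_self_eq_norm_sq, ← real_inner_self_eq_norm_sq]
  nth_rewrite 1 [inner_sub_left]
  rw [h, inner_sub_right, real_inner_comm x (S.starProjection x)]
  ring

theorem finrank_span_sup_le {n : ℕ} (u : Fin n → E) (V : Submodule ℝ E) :
    Module.finrank ℝ (Submodule.span ℝ (Set.range u) ⊔ V : Submodule ℝ E) ≤
      n + Module.finrank ℝ V := by
  refine (Submodule.finrank_add_le_finrank_add_finrank _ _).trans ?_
  gcongr
  exact (finrank_range_le_card (R := ℝ) u).trans_eq (Fintype.card_fin n)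

variable [MeasurableSpace E] [BorelSpace E]

/-- The projection jumps where the span drops dimension, but the distance to the span is an infimum
of functions continuous in the data, hence upper semicontinuous. -/
theorem measurable_norm_sub_starProjection {n : ℕ} (V : Submodule ℝ E) :
    Measurable fun q : (Fin n → E) × E =>
      ‖q.2 - (Submodule.span ℝ (Set.range q.1) ⊔ V).starProjection q.2‖ := by
  have := FiniteDimensional.proper ℝ E
  refine measurable_of_Iio fun r => ?_
  have hU : (fun q : (Fin n → E) × E =>
      ‖q.2 - (Submodule.span ℝ (Set.range q.1) ⊔ V).starProjection q.2‖) ⁻¹' Set.Iio r =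
      ⋃ (c : Fin n → ℝ) (v : V),
        {q : (Fin n → E) × E | ‖q.2 - (∑ i, c i • q.1 i + (v : E))‖ < r} := by
    ext q
    simp only [Set.mem_preimage, Set.mem_Iio, Set.mem_iUnion, Set.mem_ofPred_eq]
    constructor
    · intro h
      obtain ⟨x, hx, y, hy, hxy⟩ := Submodule.mem_sup.1
        ((Submodule.span ℝ (Set.range q.1) ⊔ V).starProjection_apply_mem q.2)
      obtain ⟨c, rfl⟩ := (Submodule.mem_span_range_iff_exists_fun ℝ).1 hx
      exact ⟨c, ⟨y, hy⟩, by rw [hxy]; exact h⟩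
    · rintro ⟨c, v, h⟩
      refine lt_of_le_of_lt ?_ h
      rw [Submodule.starProjection_minimal]
      exact ciInf_le (f := fun x : (Submodule.span ℝ (Set.range q.1) ⊔ V : Submodule ℝ E) =>
        ‖q.2 - x‖) ⟨0, by rintro _ ⟨x, rfl⟩; exact norm_nonneg _⟩
        ⟨∑ i, c i • q.1 i + v, Submodule.add_mem_sup
          ((Submodule.mem_span_range_iff_exists_fun ℝ).2 ⟨c, rfl⟩) v.2⟩
  rw [hU]
  refine (isOpen_iUnion fun c => isOpen_iUnion fun v => ?_).measurableSet
  exact isOpen_lt (by fun_prop) continuous_const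

/-- The squared distance determines the quadratic form `⟪P x, x⟫`, and polarization recovers the
coordinates of `P x`. -/
theorem measurable_starProjection_span_sup {n : ℕ} (V : Submodule ℝ E) :
    Measurable fun q : (Fin n → E) × E =>
      (Submodule.span ℝ (Set.range q.1) ⊔ V).starProjection q.2 := by
  have := FiniteDimensional.proper ℝ E
  have hquad : Measurable fun q : (Fin n → E) × E =>
      (inner ℝ ((Submodule.span ℝ (Set.range q.1) ⊔ V).starProjection q.2) q.2 : ℝ) := by
    have h : Measurable fun q : (Fin n → E) × E => ‖q.2‖ ^ 2 -
        ‖q.2 - (Submodule.span ℝ (Set.range q.1) ⊔ V).starProjection q.2‖ ^ 2 :=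
      (by fun_prop : Measurable fun q : (Fin n → E) × E => ‖q.2‖ ^ 2).sub
        ((measurable_norm_sub_starProjection V).pow_const 2)
    convert! h using 2 with q
    rw [norm_sub_starProjection_sq]
    ring
  let b := stdOrthonormalBasis ℝ E
  have hcoord : ∀ i, Measurable fun q : (Fin n → E) × E =>
      (inner ℝ (b i) ((Submodule.span ℝ (Set.range q.1) ⊔ V).starProjection q.2) : ℝ) := by
    intro i
    have hp : Measurable fun q : (Fin n → E) × E => (q.1, q.2 + b i) := by fun_prop
    have hm : Measurable fun q : (Fin n → E) × E => (q.1, q.2 - b i) := by fun_prop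
    convert! ((hquad.comp hp).sub (hquad.comp hm)).div_const 4 using 2 with q
    simp only [Pi.sub_apply, Function.comp_apply, map_add, map_sub, inner_add_left, inner_add_right, inner_sub_left,
      inner_sub_right]
    rw [Submodule.inner_starProjection_left_eq_right _ (b i) q.2,
      real_inner_comm (b i) (Submodule.starProjection _ q.2)]
    ring
  have : (fun q : (Fin n → E) × E =>
      (Submodule.span ℝ (Set.range q.1) ⊔ V).starProjection q.2) = fun q => ∑ i,
      (inner ℝ (b i) ((Submodule.span ℝ (Set.range q.1) ⊔ V).starProjection q.2) : ℝ) • b i :=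
    funext fun q => (b.sum_repr' _).symm
  rw [this]
  exact Finset.measurable_fun_sum _ fun i _ => (hcoord i).smul_const _

theorem measurable_starProjection_span_sup_comp {α : Type*} [MeasurableSpace α] {n : ℕ}
    (V : Submodule ℝ E) {f : α → Fin n → E} {g : α → E} (hf : Measurable f) (hg : Measurable g) :
    Measurable fun a => (Submodule.span ℝ (Set.range (f a)) ⊔ V).starProjection (g a) := by
  have h := Measurable.comp (measurable_starProjection_span_sup (n := n) V) (hf.prodMk hg)
  simp only [Function.comp_def] at h
  exact h

/-- If no `f g` makes the event less likely than `w` does, average over Gaussian `g` and exchange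
the order of integration: it then suffices to bound the Gaussian probability with `ω` frozen. -/
theorem measure_section_le_of_average {Ω : Type*} [MeasurableSpace Ω] (P : Measure Ω)
    [IsProbabilityMeasure P] {A : Set (Ω × E)} (hA : MeasurableSet A) {f : E → E}
    (hf : Measurable f) (w : E) {C : ENNReal}
    (h : ∀ g, P {ω | (ω, w) ∈ A} ≤ P {ω | (ω, f g) ∈ A})
    (hC : ∀ ω, stdGaussian E {g | (ω, f g) ∈ A} ≤ C) : P {ω | (ω, w) ∈ A} ≤ C := by
  have hA' : MeasurableSet ((fun q : Ω × E => (q.1, f q.2)) ⁻¹' A) :=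
    hA.preimage (by fun_prop)
  calc P {ω | (ω, w) ∈ A} = ∫⁻ _, P {ω | (ω, w) ∈ A} ∂(stdGaussian E) := by simp
    _ ≤ ∫⁻ g, P {ω | (ω, f g) ∈ A} ∂(stdGaussian E) := lintegral_mono h
    _ = (P.prod (stdGaussian E)) ((fun q : Ω × E => (q.1, f q.2)) ⁻¹' A) :=
        (Measure.prod_apply_symm hA').symm
    _ = ∫⁻ ω, stdGaussian E {g | (ω, f g) ∈ A} ∂P := Measure.prod_apply hA'
    _ ≤ ∫⁻ _, C ∂P := lintegral_mono hC
    _ = C := by simp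

theorem measurePreserving_linearIsometryEquiv (R : E ≃ₗᵢ[ℝ] E) :
    MeasurePreserving R (stdGaussian E) (stdGaussian E) :=
  ⟨R.continuous.measurable, stdGaussian_map R⟩

/-- With `S` the full span, `P_{V^⊥} g` splits into its parts in `V^⊥ ⊓ S` (dimension at most `n`)
and in `Sᗮ` (dimension at least `15 n`), the latter being the residual. The event forces the first
to dominate; the Chernoff exponent with `b = 1` is at most `n/2 - 15n/6 = -2n`. -/
theorem stdGaussian_residual_le {n : ℕ} {V : Submodule ℝ E} (hV : Module.finrank ℝ V ≤ n)
    (hn : 17 * n ≤ Module.finrank ℝ E) (u : Fin n → E) :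
    stdGaussian E {g | ‖Vᗮ.starProjection g - (Submodule.span ℝ (Set.range u) ⊔ V).starProjection
        (Vᗮ.starProjection g)‖ ^ 2 ≤ 1 / 2 * ‖Vᗮ.starProjection g‖ ^ 2} ≤
      ENNReal.ofReal (Real.exp (-(n / 4))) := by
  set S := Submodule.span ℝ (Set.range u) ⊔ V
  have hVS : V ≤ S := le_sup_right
  have h1 := Submodule.finrank_add_inf_finrank_orthogonal hVS
  have h2 := S.finrank_add_finrank_orthogonal
  have h3 : Module.finrank ℝ S ≤ n + Module.finrank ℝ V := finrank_span_sup_le u V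
  have hort : (Vᗮ ⊓ S) ⟂ Sᗮ := (Submodule.isOrtho_orthogonal_right S).mono_left inf_le_right
  have hle : (Module.finrank ℝ (Vᗮ ⊓ S : Submodule ℝ E) : ℝ) ≤ n := by
    exact_mod_cast (by omega : Module.finrank ℝ (Vᗮ ⊓ S : Submodule ℝ E) ≤ n)
  have hge : (15 * n : ℝ) ≤ Module.finrank ℝ Sᗮ := by
    exact_mod_cast (by omega : 15 * n ≤ Module.finrank ℝ Sᗮ)
  refine (measure_mono fun g hg => ?_).trans
    ((measure_projection_le _ _ hort zero_le_one).trans (ENNReal.ofReal_le_ofReal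
      (Real.exp_le_exp.2 (by norm_num; linarith))))
  have hT : (Vᗮ ⊓ S).starProjection g = S.starProjection g - V.starProjection g := by
    refine Submodule.eq_starProjection_of_mem_of_inner_eq_zero ⟨?_, ?_⟩ fun t ht => ?_
    · have := Vᗮ.sub_mem (V.sub_starProjection_mem_orthogonal g)
        (Submodule.orthogonal_le hVS (S.sub_starProjection_mem_orthogonal g))
      simpa using this
    · exact S.sub_mem (S.starProjection_apply_mem g) (hVS (V.starProjection_apply_mem g))
    · have e1 : inner ℝ t (g - S.starProjection g) = 0 :=
        S.sub_starProjection_mem_orthogonal g t ht.2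
      have e2 : inner ℝ (V.starProjection g) t = 0 := ht.1 _ (V.starProjection_apply_mem g)
      rw [real_inner_comm] at e1
      rw [sub_sub_eq_add_sub, add_sub_right_comm, inner_add_left, e1, e2, add_zero]
  have hVg : Vᗮ.starProjection g = g - V.starProjection g :=
    Submodule.starProjection_orthogonal_val g
  have hSV : S.starProjection (V.starProjection g) = V.starProjection g :=
    Submodule.starProjection_eq_self_iff.2 (hVS (V.starProjection_apply_mem g))
  have e3 : Vᗮ.starProjection g - S.starProjection (Vᗮ.starProjection g) =
      Sᗮ.starProjection g := by
    rw [hVg, map_sub, hSV, Submodule.starProjection_orthogonal_val]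
    abel
  have e4 : Vᗮ.starProjection g = (Vᗮ ⊓ S).starProjection g + Sᗮ.starProjection g := by
    rw [hVg, hT, Submodule.starProjection_orthogonal_val]
    abel
  have e5 := norm_add_sq_eq_norm_sq_add_norm_sq_of_inner_eq_zero _ _
    (hort.inner_eq ((Vᗮ ⊓ S).starProjection_apply_mem g) (Sᗮ.starProjection_apply_mem g))
  rw [← e4] at e5
  rw [Set.mem_ofPred_eq, e3] at hg
  rw [Set.mem_ofPred_eq]
  nlinarith

theorem pi_stdGaussian_residual_le {n : ℕ} {V : Submodule ℝ E} (hV : Module.finrank ℝ V ≤ n)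
    (hn : 17 * n ≤ Module.finrank ℝ E) {w : E} (hw : w ≠ 0) (hwV : w ∈ Vᗮ) :
    (Measure.pi fun _ : Fin n => stdGaussian E)
      {u | ‖w - (Submodule.span ℝ (Set.range u) ⊔ V).starProjection w‖ ^ 2 ≤
        1 / 2 * ‖w‖ ^ 2} ≤ ENNReal.ofReal (Real.exp (-(n / 4))) := by
  have := FiniteDimensional.proper ℝ E
  let A : Set ((Fin n → E) × E) := {q | ‖q.2 - (Submodule.span ℝ (Set.range q.1) ⊔
    V).starProjection q.2‖ ^ 2 ≤ 1 / 2 * ‖q.2‖ ^ 2}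
  have hA : MeasurableSet A := measurableSet_le
    ((measurable_norm_sub_starProjection V).pow_const 2) (by fun_prop)
  refine measure_section_le_of_average (A := A) _ hA
    (Vᗮ.starProjection.continuous.measurable) w (fun g => ?_)
    (stdGaussian_residual_le hV hn)
  set g' := Vᗮ.starProjection g with hg'
  by_cases hg0 : g' = 0
  -- At the zero vector the event reads `0 ≤ 0` and always holds.
  · refine measure_mono fun u _ => ?_
    simp [A, hg0]
  -- The event is invariant under scaling the vector, and `R` fixes `V` pointwise while preserving
  -- the law of `u`.
  obtain ⟨R, c, hc, hR, hfix⟩ := exists_reflection_smul hw hg0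
  have hRV : ∀ v ∈ V, R v = v := fun v hv =>
    hfix v (hwV v hv) ((Vᗮ.starProjection_apply_mem g) v hv)
  have hmp : MeasurePreserving (fun (u : Fin n → E) i => R (u i))
      (Measure.pi fun _ : Fin n => stdGaussian E) (Measure.pi fun _ : Fin n => stdGaussian E) :=
    measurePreserving_pi _ _ fun _ => measurePreserving_linearIsometryEquiv R
  have hs : MeasurableSet {u : Fin n → E | (u, g') ∈ A} := hA.preimage (by fun_prop)
  rw [← hmp.measure_preimage hs.nullMeasurableSet]
  refine measure_mono fun u hu => ?_
  have hu' : ‖R w - (Submodule.span ℝ (Set.range fun i => R (u i)) ⊔ V).starProjection (R w)‖ ^ 2 ≤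
      1 / 2 * ‖R w‖ ^ 2 := by
    simp only [span_range_comp_sup R u hRV]
    have := Submodule.starProjection_map_apply R (Submodule.span ℝ (Set.range u) ⊔ V) (R w)
    rw [R.symm_apply_apply] at this
    rw [this, ← map_sub, R.norm_map, R.norm_map]
    exact hu
  rw [hR, map_smul, ← smul_sub, norm_smul, norm_smul, mul_pow, mul_pow] at hu'
  have hc2 : 0 < ‖c‖ ^ 2 := by have := norm_pos_iff.2 hc.ne'; positivity
  show ‖_‖ ^ 2 ≤ 1 / 2 * ‖_‖ ^ 2
  nlinarith

end Averaging

/-! ### Haar-random rotations. -/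

section Orthogonal

variable {p : ℕ}

/-- The orthogonal group acting by linear isometries on Euclidean space. -/
noncomputable def orthogonalIsometry : Matrix.orthogonalGroup (Fin p) ℝ ≃*
    (EuclideanSpace ℝ (Fin p) ≃ₗᵢ[ℝ] EuclideanSpace ℝ (Fin p)) :=
  (Unitary.mapEquiv (R := Matrix (Fin p) (Fin p) ℝ)
    ⟨MulEquivClass.toMulEquiv (Matrix.toEuclideanCLM (n := Fin p) (𝕜 := ℝ)),
      map_star (Matrix.toEuclideanCLM (n := Fin p) (𝕜 := ℝ))⟩).toMulEquiv.trans
    Unitary.linearIsometryEquiv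

theorem ofLp_orthogonalIsometry (O : Matrix.orthogonalGroup (Fin p) ℝ)
    (x : EuclideanSpace ℝ (Fin p)) :
    (orthogonalIsometry O x).ofLp = (O : Matrix (Fin p) (Fin p) ℝ) *ᵥ x.ofLp := rfl

theorem measurable_orthogonalIsometry :
    Measurable fun q : Matrix.orthogonalGroup (Fin p) ℝ × EuclideanSpace ℝ (Fin p) =>
      orthogonalIsometry q.1 q.2 := by
  have h : Measurable fun q : Matrix.orthogonalGroup (Fin p) ℝ × EuclideanSpace ℝ (Fin p) =>
      (orthogonalIsometry q.1 q.2).ofLp := by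
    refine measurable_pi_iff.2 fun i => ?_
    simp only [ofLp_orthogonalIsometry, Matrix.mulVec, dotProduct]
    refine Finset.measurable_fun_sum _ fun j _ => ?_
    have h1 : Measurable fun O : Matrix.orthogonalGroup (Fin p) ℝ =>
        (O : Matrix (Fin p) (Fin p) ℝ) i j :=
      (Continuous.matrix_elem continuous_subtype_val i j).measurable
    have h2 : Measurable fun x : EuclideanSpace ℝ (Fin p) => x.ofLp j := by fun_prop
    exact (h1.comp measurable_fst).mul (h2.comp measurable_snd)
  exact (WithLp.measurable_toLp 2 _).comp h

/-- A right translate of a Haar probability measure is again one, and such a measure is unique. -/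
theorem isMulRightInvariant_of_isHaarMeasure (haar : Measure (Matrix.orthogonalGroup (Fin p) ℝ))
    [haar.IsHaarMeasure] [IsProbabilityMeasure haar] : haar.IsMulRightInvariant := by
  have hcl : Topology.IsClosedEmbedding
      ((↑) : Matrix.orthogonalGroup (Fin p) ℝ → Matrix (Fin p) (Fin p) ℝ) :=
    isClosed_unitary.isClosedEmbedding_subtypeVal
  have : LocallyCompactSpace (Matrix (Fin p) (Fin p) ℝ) :=
    inferInstanceAs (LocallyCompactSpace (Fin p → Fin p → ℝ))
  have : LocallyCompactSpace (Matrix.orthogonalGroup (Fin p) ℝ) := hcl.locallyCompactSpace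
  refine ⟨fun g => ?_⟩
  have : IsProbabilityMeasure (haar.map (· * g)) :=
    Measure.isProbabilityMeasure_map (measurable_mul_const g).aemeasurable
  exact Measure.isHaarMeasure_eq_of_isProbabilityMeasure _ _

theorem stdGaussian_rotation_projection_le {n : ℕ} {S : Submodule ℝ (EuclideanSpace ℝ (Fin p))}
    (hS : Module.finrank ℝ S ≤ n) (hn : 17 * n ≤ p) (hp : 0 < p)
    (O : Matrix.orthogonalGroup (Fin p) ℝ) :
    stdGaussian (EuclideanSpace ℝ (Fin p)) {g | 4 * (n / p : ℝ) * ‖g‖ ^ 2 ≤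
      ‖S.starProjection (orthogonalIsometry O g)‖ ^ 2} ≤
      ENNReal.ofReal (Real.exp (-(n / 4))) := by
  have hs : MeasurableSet {g : EuclideanSpace ℝ (Fin p) | 4 * (n / p : ℝ) * ‖g‖ ^ 2 ≤
      ‖S.starProjection g‖ ^ 2} :=
    measurableSet_le (by fun_prop) (by fun_prop)
  have h0 := (measurePreserving_linearIsometryEquiv (orthogonalIsometry O)).measure_preimage
    hs.nullMeasurableSet
  simp only [Set.preimage_ofPred_eq, LinearIsometryEquiv.norm_map] at h0
  rw [h0]
  have h2 := S.finrank_add_finrank_orthogonal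
  rw [finrank_euclideanSpace_fin] at h2
  have hle : (Module.finrank ℝ S : ℝ) ≤ n := by exact_mod_cast hS
  have hge : (p - n : ℝ) ≤ Module.finrank ℝ Sᗮ := by
    have : (Module.finrank ℝ S : ℝ) + Module.finrank ℝ Sᗮ = p := by exact_mod_cast h2
    linarith
  have hp' : (0 : ℝ) < p := by exact_mod_cast hp
  have hn' : (17 * n : ℝ) ≤ p := by exact_mod_cast hn
  refine (measure_mono fun g hg => ?_).trans
    ((measure_projection_le S Sᗮ (Submodule.isOrtho_orthogonal_right S)
      (b := 4 * (n / p : ℝ)) (by positivity)).trans (ENNReal.ofReal_le_ofReal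
      (Real.exp_le_exp.2 ?_)))
  · simp only [Set.mem_ofPred_eq] at hg ⊢
    refine le_trans ?_ hg
    gcongr
    exact Submodule.norm_starProjection_apply_le _ g
  -- The exponent is at most `n/2 - 3n/4`, since `(p - n) / (p + 2n) ≥ 3/4` once `p ≥ 10 n`.
  · have e : 4 * (n / p : ℝ) / 4 / (1 + 2 * (4 * (n / p : ℝ) / 4)) = n / (p + 2 * n) := by
      field_simp
    have h3 : 3 / 4 * (n : ℝ) ≤ n / (p + 2 * n) * (p - n) := by
      rw [div_mul_eq_mul_div (n : ℝ), le_div_iff₀ (by positivity)]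
      have : (0 : ℝ) ≤ n := by positivity
      nlinarith
    have h4 : (n / (p + 2 * n) : ℝ) * (p - n) ≤ n / (p + 2 * n) * Module.finrank ℝ Sᗮ := by
      gcongr
    rw [e]
    linarith

/-- Right translation of `O` by an isometry taking `g` to a multiple of `β` carries the event for
`β` to the event for `g`, so `β` may be taken Gaussian. -/
theorem rotation_projection_le {n : ℕ} {S : Submodule ℝ (EuclideanSpace ℝ (Fin p))}
    (hS : Module.finrank ℝ S ≤ n) (hn : 17 * n ≤ p) (hp : 0 < p)
    (ν : Measure (Matrix.orthogonalGroup (Fin p) ℝ)) [IsProbabilityMeasure ν]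
    [ν.IsMulRightInvariant] {β : EuclideanSpace ℝ (Fin p)} (hβ : β ≠ 0) :
    ν {O | 4 * (n / p : ℝ) * ‖β‖ ^ 2 ≤ ‖S.starProjection (orthogonalIsometry O β)‖ ^ 2} ≤
      ENNReal.ofReal (Real.exp (-(n / 4))) := by
  let A : Set (Matrix.orthogonalGroup (Fin p) ℝ × EuclideanSpace ℝ (Fin p)) :=
    {q | 4 * (n / p : ℝ) * ‖q.2‖ ^ 2 ≤ ‖S.starProjection (orthogonalIsometry q.1 q.2)‖ ^ 2}
  have hA : MeasurableSet A := measurableSet_le (by fun_prop)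
    ((S.starProjection.continuous.measurable.comp measurable_orthogonalIsometry).norm.pow_const 2)
  refine measure_section_le_of_average (A := A) _ hA measurable_id β (fun g => ?_)
    (stdGaussian_rotation_projection_le hS hn hp)
  by_cases hg0 : g = 0
  · refine measure_mono fun u _ => ?_
    simp [A, hg0]
  obtain ⟨R, c, hc, hR, -⟩ := exists_reflection_smul hβ hg0
  have hs : MeasurableSet {O | (O, g) ∈ A} := hA.preimage (by fun_prop)
  rw [id, ← (measurePreserving_mul_right ν (orthogonalIsometry.symm R⁻¹)).measure_preimage
    hs.nullMeasurableSet]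
  refine measure_mono fun O hO => ?_
  have e1 : R⁻¹ g = c⁻¹ • β := by
    rw [LinearIsometryEquiv.inv_def, LinearIsometryEquiv.symm_apply_eq, map_smul, hR,
      inv_smul_smul₀ hc.ne']
  have e2 : orthogonalIsometry (O * orthogonalIsometry.symm R⁻¹) g =
      c⁻¹ • orthogonalIsometry O β := by
    rw [map_mul, MulEquiv.apply_symm_apply, LinearIsometryEquiv.coe_mul, Function.comp_apply, e1, map_smul]
  have e3 : ‖g‖ = ‖c⁻¹‖ * ‖β‖ := by rw [← norm_smul, ← e1, LinearIsometryEquiv.norm_map]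
  show 4 * (n / p : ℝ) * ‖g‖ ^ 2 ≤
    ‖S.starProjection (orthogonalIsometry (O * orthogonalIsometry.symm R⁻¹) g)‖ ^ 2
  rw [e2, e3, map_smul, norm_smul, mul_pow, mul_pow, mul_left_comm]
  exact mul_le_mul_of_nonneg_left hO (sq_nonneg _)

end Orthogonal

/-! ### The risk in closed form. -/

section Risk

variable {E : Type*} [NormedAddCommGroup E] [InnerProductSpace ℝ E] [FiniteDimensional ℝ E]
  [MeasurableSpace E] [BorelSpace E]

theorem memLp_inner_stdGaussian (a : E) :
    MemLp (fun z => (inner ℝ z a : ℝ)) 2 (stdGaussian E) := by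
  simpa [real_inner_comm] using
    IsGaussian.memLp_dual (stdGaussian E) (innerSL ℝ a) 2 (by simp)

theorem integral_inner_stdGaussian (a : E) : ∫ z, (inner ℝ z a : ℝ) ∂(stdGaussian E) = 0 := by
  simpa [real_inner_comm] using integral_strongDual_stdGaussian (innerSL ℝ a)

theorem integral_inner_sq_stdGaussian (a : E) :
    ∫ z, (inner ℝ z a : ℝ) ^ 2 ∂(stdGaussian E) = ‖a‖ ^ 2 := by
  have h := variance_dual_stdGaussian (innerSL ℝ a)
  rw [variance_of_integral_eq_zero (innerSL ℝ a).continuous.measurable.aemeasurable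
    (integral_strongDual_stdGaussian _), innerSL_apply_norm] at h
  simpa [real_inner_comm] using h

theorem integral_add_sq_prod_stdGaussian {F : Type*} [NormedAddCommGroup F]
    [InnerProductSpace ℝ F] [FiniteDimensional ℝ F] [MeasurableSpace F] [BorelSpace F]
    (a : F) (b : E) :
    ∫ e : F × E, ((inner ℝ e.1 a : ℝ) + inner ℝ e.2 b) ^ 2
      ∂((stdGaussian F).prod (stdGaussian E)) = ‖a‖ ^ 2 + ‖b‖ ^ 2 := by
  have h1 : Integrable (fun e : F × E => (inner ℝ e.1 a : ℝ) ^ 2)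
      ((stdGaussian F).prod (stdGaussian E)) :=
    (memLp_inner_stdGaussian a).integrable_sq.comp_fst _
  have h2 : Integrable (fun e : F × E => (inner ℝ e.2 b : ℝ) ^ 2)
      ((stdGaussian F).prod (stdGaussian E)) :=
    (memLp_inner_stdGaussian b).integrable_sq.comp_snd _
  have h3 : Integrable (fun e : F × E => 2 * ((inner ℝ e.1 a : ℝ) * inner ℝ e.2 b))
      ((stdGaussian F).prod (stdGaussian E)) :=
    (((memLp_inner_stdGaussian a).integrable one_le_two).mul_prod
      ((memLp_inner_stdGaussian b).integrable one_le_two)).const_mul 2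
  have h13 : Integrable (fun e : F × E => (inner ℝ e.1 a : ℝ) ^ 2 +
      2 * ((inner ℝ e.1 a : ℝ) * inner ℝ e.2 b)) ((stdGaussian F).prod (stdGaussian E)) :=
    h1.add h3
  calc ∫ e : F × E, ((inner ℝ e.1 a : ℝ) + inner ℝ e.2 b) ^ 2
      ∂((stdGaussian F).prod (stdGaussian E))
      = ∫ e : F × E, ((inner ℝ e.1 a : ℝ) ^ 2 + 2 * ((inner ℝ e.1 a : ℝ) * inner ℝ e.2 b)) +
          (inner ℝ e.2 b : ℝ) ^ 2 ∂((stdGaussian F).prod (stdGaussian E)) :=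
        integral_congr_ae (Filter.Eventually.of_forall fun e => by ring)
    _ = _ := by
        rw [integral_add h13 h2, integral_add h1 h3, integral_const_mul,
          integral_prod_mul (fun z : F => (inner ℝ z a : ℝ)) (fun u : E => (inner ℝ u b : ℝ)),
          integral_inner_stdGaussian, integral_fun_fst (fun z : F => (inner ℝ z a : ℝ) ^ 2),
          integral_fun_snd (fun u : E => (inner ℝ u b : ℝ) ^ 2),
          integral_inner_sq_stdGaussian, integral_inner_sq_stdGaussian]
        simp

theorem risk_eq {p d : ℕ} (W : Matrix (Fin p) (Fin d) ℝ) (θ : EuclideanSpace ℝ (Fin d))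
    (b : EuclideanSpace ℝ (Fin p)) :
    risk W θ b = ‖(Matrix.toEuclideanLin W).adjoint b - θ‖ ^ 2 + ‖b‖ ^ 2 := by
  rw [risk, ← integral_add_sq_prod_stdGaussian]
  refine integral_congr_ae (Filter.Eventually.of_forall fun e => ?_)
  have h : observed W e.1 e.2 = Matrix.toEuclideanLin W e.1 + e.2 := rfl
  simp only [h, response, inner_add_left, inner_sub_right, LinearMap.adjoint_inner_right]
  ring

end Risk

/-! ### Closest interpolators and the row space. -/

section Interpolators

variable {n p : ℕ}

theorem mulVec_of_rows (r : Fin n → EuclideanSpace ℝ (Fin p)) (b : EuclideanSpace ℝ (Fin p)) :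
    (Matrix.of fun i => (r i).ofLp) *ᵥ b.ofLp = fun i => inner ℝ (r i) b := by
  ext i
  simp [Matrix.mulVec, dotProduct, PiLp.inner_apply, mul_comm]

/-- Two interpolators differ by a vector orthogonal to all rows, so Pythagoras applies. -/
theorem isClosestInterpolator_of_sub_mem_span {r : Fin n → EuclideanSpace ℝ (Fin p)}
    {y : Fin n → ℝ} {b₀ b : EuclideanSpace ℝ (Fin p)} (h : ∀ i, inner ℝ (r i) b = y i)
    (hb : b - b₀ ∈ Submodule.span ℝ (Set.range r)) :
    IsClosestInterpolator (Matrix.of fun i => (r i).ofLp) y b₀ b := by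
  refine ⟨by rw [mulVec_of_rows]; exact funext fun i => (h i).symm,
    isMinOn_iff.2 fun b' hb' => ?_⟩
  rw [Set.mem_ofPred_eq, mulVec_of_rows] at hb'
  have hort : b' - b ∈ (Submodule.span ℝ (Set.range r))ᗮ := by
    rw [Submodule.mem_orthogonal]
    intro x hx
    induction hx using Submodule.span_induction with
    | mem x hx =>
      obtain ⟨i, rfl⟩ := hx
      rw [inner_sub_right, h, hb', sub_self]
    | zero => simp
    | add x y _ _ hx hy => rw [inner_add_left, hx, hy, add_zero]
    | smul c x _ hx => rw [inner_smul_left, hx, mul_zero]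
  have e := norm_add_sq_eq_norm_sq_add_norm_sq_of_inner_eq_zero _ _ (hort _ hb)
  rw [sub_add_sub_cancel'] at e
  have := mul_self_nonneg ‖b' - b‖
  show 1 / 2 * ‖b - b₀‖ ^ 2 ≤ 1 / 2 * ‖b' - b₀‖ ^ 2
  nlinarith

theorem dataB_eq {d : ℕ} (W : Matrix (Fin p) (Fin d) ℝ) (Z : Fin n → EuclideanSpace ℝ (Fin d))
    (U : Fin n → EuclideanSpace ℝ (Fin p)) (O : Matrix.orthogonalGroup (Fin p) ℝ) :
    dataB W Z U O =
      Matrix.of fun i => (orthogonalIsometry O (observed W (Z i) (U i))).ofLp := by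
  ext i j
  simp [dataB, dataA, Matrix.mul_apply, ofLp_orthogonalIsometry, Matrix.mulVec, dotProduct,
    mul_comm]

end Interpolators

/-! ### Deterministic bounds for the cheap interpolator and the risk increase. -/

section Transfer

variable {E F : Type*} [NormedAddCommGroup E] [InnerProductSpace ℝ E] [FiniteDimensional ℝ E]
  [NormedAddCommGroup F] [InnerProductSpace ℝ F] [FiniteDimensional ℝ F]

theorem norm_sq_adjoint_le {L : F →ₗ[ℝ] E} {κ : ℝ} (hκ : 0 ≤ κ)
    (hL : ∀ a b, inner ℝ (L a) (L b) = κ * inner ℝ a b) (x : E) :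
    ‖L.adjoint x‖ ^ 2 ≤ κ * ‖L.range.starProjection x‖ ^ 2 := by
  set y := L.adjoint x
  have h1 : ‖L y‖ ^ 2 = κ * ‖y‖ ^ 2 := by
    rw [← real_inner_self_eq_norm_sq, hL, real_inner_self_eq_norm_sq]
  have h2 : ‖y‖ ^ 2 = inner ℝ (L y) (L.range.starProjection x) := by
    rw [← Submodule.inner_starProjection_left_eq_right,
      Submodule.starProjection_eq_self_iff.2 (LinearMap.mem_range_self L y),
      ← LinearMap.adjoint_inner_right, real_inner_self_eq_norm_sq]
  have h3 : ‖y‖ ^ 2 ≤ ‖L y‖ * ‖L.range.starProjection x‖ := h2 ▸ real_inner_le_norm _ _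
  have h4 : (‖y‖ ^ 2) ^ 2 ≤ (κ * ‖y‖ ^ 2) * ‖L.range.starProjection x‖ ^ 2 := by
    rw [← h1, ← mul_pow]
    gcongr
  rcases (sq_nonneg ‖y‖).eq_or_lt with h0 | h0
  · rw [← h0]; positivity
  · nlinarith

theorem risk_increase_le {L : F →ₗ[ℝ] E} {κ s : ℝ} (hκ : 0 < κ) (hs : 0 ≤ s) (hs' : s ≤ 1 / 4)
    (hL : ∀ a b, inner ℝ (L a) (L b) = κ * inner ℝ a b) {R : Submodule ℝ E} {β : E} {θ : F}
    (hβR : β ∈ R) (hβ : κ * ‖β‖ ^ 2 ≤ 2 * ‖θ‖ ^ 2) (Q : E ≃ₗᵢ[ℝ] E)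
    (h1 : ‖R.starProjection (Q.symm β)‖ ^ 2 ≤ 4 * s ^ 2 * ‖β‖ ^ 2)
    (h2 : ‖L.range.starProjection (Q β)‖ ^ 2 ≤ 4 * s ^ 2 * ‖β‖ ^ 2) :
    ‖L.adjoint (β + Q (R.starProjection (β - Q.symm β))) - θ‖ ^ 2 +
        ‖β + Q (R.starProjection (β - Q.symm β))‖ ^ 2 -
        (‖L.adjoint β - θ‖ ^ 2 + ‖β‖ ^ 2) ≤ (66 * s + 12 / κ) * ‖θ‖ ^ 2 := by
  set x := Q.symm β with hx
  set N := ‖θ‖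
  have hN : 0 ≤ N := norm_nonneg _
  have hβ' : β + Q (R.starProjection (β - x)) = Q (x - R.starProjection x + β) := by
    rw [map_sub R.starProjection, Submodule.starProjection_eq_self_iff.2 hβR]
    simp only [map_sub, map_add, hx, Q.apply_symm_apply]
    abel
  have hnorm : ‖β + Q (R.starProjection (β - x))‖ ^ 2 ≤ 2 * ‖β‖ ^ 2 := by
    have e := norm_add_sq_eq_norm_sq_add_norm_sq_of_inner_eq_zero (x - R.starProjection x) β
      (by rw [real_inner_comm]; exact R.sub_starProjection_mem_orthogonal x β hβR)
    have e' : ‖x - R.starProjection x‖ ≤ ‖β‖ := by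
      rw [← Submodule.starProjection_orthogonal_val]
      refine (Submodule.norm_starProjection_apply_le _ _).trans_eq ?_
      rw [hx, Q.symm.norm_map]
    have := norm_nonneg (x - R.starProjection x)
    rw [hβ', Q.norm_map]
    nlinarith
  have hsplit : L.adjoint (β + Q (R.starProjection (β - x))) - θ =
      (L.adjoint β - θ) + (L.adjoint (Q β) - L.adjoint (Q (R.starProjection x))) := by
    rw [map_sub R.starProjection, Submodule.starProjection_eq_self_iff.2 hβR, map_sub Q, map_add,
      map_sub]
    abel
  have ha : ‖L.adjoint β‖ ≤ 3 / 2 * N := by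
    refine abs_le_of_sq_le_sq' ?_ (by positivity) |>.2
    have := norm_sq_adjoint_le hκ.le hL β
    have h := Submodule.norm_starProjection_apply_le L.range β
    have h' : ‖L.range.starProjection β‖ ^ 2 ≤ ‖β‖ ^ 2 := by gcongr
    nlinarith
  have hb : ‖L.adjoint (Q β)‖ ≤ 3 * s * N := by
    refine abs_le_of_sq_le_sq' ?_ (by positivity) |>.2
    have := norm_sq_adjoint_le hκ.le hL (Q β)
    have h3 := mul_le_mul_of_nonneg_left h2 hκ.le
    have h4 := mul_le_mul_of_nonneg_left hβ (sq_nonneg s)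
    have h5 := sq_nonneg (s * N)
    nlinarith
  have hc : ‖L.adjoint (Q (R.starProjection x))‖ ≤ 3 * s * N := by
    refine abs_le_of_sq_le_sq' ?_ (by positivity) |>.2
    have := norm_sq_adjoint_le hκ.le hL (Q (R.starProjection x))
    have h := Submodule.norm_starProjection_apply_le L.range (Q (R.starProjection x))
    rw [Q.norm_map] at h
    have h' : ‖L.range.starProjection (Q (R.starProjection x))‖ ^ 2 ≤
        ‖R.starProjection x‖ ^ 2 := by gcongr
    have h3 := mul_le_mul_of_nonneg_left (h'.trans h1) hκ.le
    have h4 := mul_le_mul_of_nonneg_left hβ (sq_nonneg s)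
    have h5 := sq_nonneg (s * N)
    nlinarith
  set a := L.adjoint β - θ
  set δ := L.adjoint (Q β) - L.adjoint (Q (R.starProjection x))
  have ha' : ‖a‖ ≤ 5 / 2 * N := (norm_sub_le _ _).trans (by linarith)
  have hδ : ‖δ‖ ≤ 6 * s * N := (norm_sub_le _ _).trans (by linarith)
  -- The cross term gives `2 · 5/2 · 6 = 30`; the square `36 s²` is at most `9 s` because `s ≤ 1/4`.
  have hsum : ‖a + δ‖ ^ 2 - ‖a‖ ^ 2 ≤ 39 * s * N ^ 2 := by
    have e1 : ‖a + δ‖ ^ 2 ≤ (‖a‖ + ‖δ‖) ^ 2 := by gcongr; exact norm_add_le _ _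
    have e2 : ‖a‖ * ‖δ‖ ≤ 5 / 2 * N * (6 * s * N) := by gcongr
    have e3 : ‖δ‖ ^ 2 ≤ (6 * s * N) ^ 2 := by gcongr
    have e4 : s * (s * N ^ 2) ≤ 1 / 4 * (s * N ^ 2) := by gcongr
    nlinarith
  have hM : ‖β‖ ^ 2 ≤ 12 / κ * N ^ 2 := by
    rw [div_mul_eq_mul_div, le_div_iff₀ hκ]
    nlinarith [sq_nonneg N]
  rw [hsplit]
  have : 0 ≤ s * N ^ 2 := by positivity
  linarith

/-- The multiple of the component of `w` orthogonal to `S` whose inner product with `w` is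
`‖w‖ ^ 2`. -/
noncomputable def rescaledResidual (S : Submodule ℝ E) (w : E) : E :=
  (‖w‖ ^ 2 / ‖w - S.starProjection w‖ ^ 2) • (w - S.starProjection w)

theorem measurable_rescaledResidual {α : Type*} [MeasurableSpace α] [MeasurableSpace E]
    [BorelSpace E] {n : ℕ} (V : Submodule ℝ E) {f : α → Fin n → E} (hf : Measurable f) (w : E) :
    Measurable fun a => rescaledResidual (Submodule.span ℝ (Set.range (f a)) ⊔ V) w := by
  have := FiniteDimensional.proper ℝ E
  have h : Measurable fun a => w - (Submodule.span ℝ (Set.range (f a)) ⊔ V).starProjection w :=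
    measurable_const.sub (measurable_starProjection_span_sup_comp V hf measurable_const)
  exact (measurable_const.div (h.norm.pow_const 2)).smul h

theorem inner_rescaledResidual_of_mem {S : Submodule ℝ E} (w : E) {x : E} (hx : x ∈ S) :
    inner ℝ x (rescaledResidual S w) = 0 := by
  rw [rescaledResidual, inner_smul_right, S.sub_starProjection_mem_orthogonal w x hx, mul_zero]

theorem inner_rescaledResidual_self {S : Submodule ℝ E} {w : E}
    (h : 1 / 2 * ‖w‖ ^ 2 < ‖w - S.starProjection w‖ ^ 2) :
    inner ℝ w (rescaledResidual S w) = ‖w‖ ^ 2 := by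
  have h0 : ‖w - S.starProjection w‖ ^ 2 ≠ 0 := by
    have := sq_nonneg ‖w‖
    linarith
  rw [rescaledResidual, inner_smul_right, inner_sub_right, real_inner_self_eq_norm_sq,
    real_inner_comm, ← norm_sub_starProjection_sq, div_mul_cancel₀ _ h0]

theorem norm_rescaledResidual_sq_le {S : Submodule ℝ E} {w : E}
    (h : 1 / 2 * ‖w‖ ^ 2 < ‖w - S.starProjection w‖ ^ 2) :
    ‖rescaledResidual S w‖ ^ 2 ≤ 2 * ‖w‖ ^ 2 := by
  have h0 : 0 < ‖w - S.starProjection w‖ ^ 2 := by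
    have := sq_nonneg ‖w‖
    linarith
  rw [rescaledResidual, norm_smul, mul_pow, Real.norm_of_nonneg (by positivity), div_pow,
    sq (‖w - S.starProjection w‖ ^ 2), ← div_div, div_mul_cancel₀ _ h0.ne', div_le_iff₀ h0]
  nlinarith [sq_nonneg ‖w‖]

/-- Orthogonality to `L(θ^⊥)` puts the adjoint image on the line of `θ`; the normalization of the
residual fixes the multiple. -/
theorem adjoint_rescaledResidual {L : F →ₗ[ℝ] E} {κ : ℝ} (hκ : 0 < κ)
    (hL : ∀ a b, inner ℝ (L a) (L b) = κ * inner ℝ a b) {θ : F} {S : Submodule ℝ E}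
    (hS : (ℝ ∙ θ)ᗮ.map L ≤ S)
    (h : 1 / 2 * ‖κ⁻¹ • L θ‖ ^ 2 < ‖κ⁻¹ • L θ - S.starProjection (κ⁻¹ • L θ)‖ ^ 2) :
    L.adjoint (rescaledResidual S (κ⁻¹ • L θ)) = θ := by
  have e := inner_rescaledResidual_self h
  have hort : ∀ y ∈ (ℝ ∙ θ)ᗮ, inner ℝ (L y) (rescaledResidual S (κ⁻¹ • L θ)) = 0 :=
    fun y hy => inner_rescaledResidual_of_mem _ (hS (Submodule.mem_map_of_mem hy))
  generalize rescaledResidual S (κ⁻¹ • L θ) = b at e hort ⊢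
  have hθ : inner ℝ (L θ) b = inner ℝ θ θ := by
    rw [inner_smul_left, ← real_inner_self_eq_norm_sq, inner_smul_left, inner_smul_right, hL] at e
    simp only [map_inv₀, conj_trivial] at e
    field_simp at e
    exact e
  refine ext_inner_left ℝ fun a => ?_
  rw [LinearMap.adjoint_inner_right]
  obtain ⟨x, hx, y, hy, rfl⟩ := (ℝ ∙ θ).exists_add_mem_mem_orthogonal a
  obtain ⟨c, rfl⟩ := Submodule.mem_span_singleton.1 hx
  rw [map_add, map_smul, inner_add_left, inner_add_left, inner_smul_left, inner_smul_left, hθ,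
    hort y hy,
    Submodule.mem_orthogonal_singleton_iff_inner_left.1 hy]

end Transfer

/-! ### The three bad events and their complement. -/

theorem measure_prod_prod_le_of_section_le {α β δ : Type*} [MeasurableSpace α] [MeasurableSpace β]
    [MeasurableSpace δ] (μ₁ : Measure α) (μ₂ : Measure β) (μ₃ : Measure δ)
    [IsProbabilityMeasure μ₁] [IsProbabilityMeasure μ₂] [IsProbabilityMeasure μ₃]
    {A : Set (α × β × δ)} (hA : MeasurableSet A) {C : ENNReal}
    (h : ∀ a b, μ₃ {c | (a, b, c) ∈ A} ≤ C) : μ₁.prod (μ₂.prod μ₃) A ≤ C := by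
  rw [Measure.prod_apply hA]
  refine (lintegral_mono (g := fun _ => C) fun a => ?_).trans_eq (by simp)
  rw [Measure.prod_apply (hA.preimage measurable_prodMk_left)]
  exact (lintegral_mono (g := fun _ => C) fun b => h a b).trans_eq (by simp)

theorem symm_orthogonalIsometry {p : ℕ} (O : Matrix.orthogonalGroup (Fin p) ℝ) :
    (orthogonalIsometry O).symm = orthogonalIsometry O⁻¹ := by
  rw [map_inv, LinearIsometryEquiv.inv_def]

/-- Inversion turns a left-invariant law into a right-invariant one. -/
theorem rotation_symm_projection_le {n p : ℕ} {S : Submodule ℝ (EuclideanSpace ℝ (Fin p))}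
    (hS : Module.finrank ℝ S ≤ n) (hn : 17 * n ≤ p) (hp : 0 < p)
    (ν : Measure (Matrix.orthogonalGroup (Fin p) ℝ)) [IsProbabilityMeasure ν]
    [ν.IsMulLeftInvariant] {β : EuclideanSpace ℝ (Fin p)} (hβ : β ≠ 0) :
    ν {O | 4 * (n / p : ℝ) * ‖β‖ ^ 2 ≤
      ‖S.starProjection ((orthogonalIsometry O).symm β)‖ ^ 2} ≤
      ENNReal.ofReal (Real.exp (-(n / 4))) := by
  have : IsProbabilityMeasure ν.inv :=
    Measure.isProbabilityMeasure_map measurable_inv.aemeasurable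
  have h := rotation_projection_le hS hn hp ν.inv hβ
  rw [Measure.inv_apply] at h
  simp only [symm_orthogonalIsometry]
  exact h

section Measurability

variable {α : Type*} [MeasurableSpace α] {n p d : ℕ}

theorem measurable_observed (W : Matrix (Fin p) (Fin d) ℝ) {z : α → EuclideanSpace ℝ (Fin d)}
    {u : α → EuclideanSpace ℝ (Fin p)} (hz : Measurable z) (hu : Measurable u) :
    Measurable fun a => observed W (z a) (u a) :=
  ((LinearMap.continuous_of_finiteDimensional (Matrix.toEuclideanLin W)).measurable.comp hz).add hu

theorem measurable_orthogonalIsometry_comp {O : α → Matrix.orthogonalGroup (Fin p) ℝ}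
    {x : α → EuclideanSpace ℝ (Fin p)} (hO : Measurable O) (hx : Measurable x) :
    Measurable fun a => orthogonalIsometry (O a) (x a) := by
  have h := Measurable.comp measurable_orthogonalIsometry (hO.prodMk hx)
  simp only [Function.comp_def] at h
  exact h

end Measurability

theorem inner_toEuclideanLin {p d : ℕ} {W : Matrix (Fin p) (Fin d) ℝ} {κ : ℝ}
    (hW : Wᵀ * W = κ • (1 : Matrix (Fin d) (Fin d) ℝ)) (a b : EuclideanSpace ℝ (Fin d)) :
    inner ℝ (Matrix.toEuclideanLin W a) (Matrix.toEuclideanLin W b) = κ * inner ℝ a b := by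
  have h : (W *ᵥ b.ofLp) ⬝ᵥ (W *ᵥ a.ofLp) = κ * (b.ofLp ⬝ᵥ a.ofLp) := by
    rw [Matrix.dotProduct_mulVec, ← Matrix.mulVec_transpose, Matrix.mulVec_mulVec, hW,
      Matrix.smul_mulVec, Matrix.one_mulVec, smul_dotProduct, smul_eq_mul]
  simpa [EuclideanSpace.inner_eq_star_dotProduct] using h

theorem prod_rotation_projection_le {α δ : Type*} [MeasurableSpace α] [MeasurableSpace δ]
    {n p : ℕ} (hn : 17 * n ≤ p) (hp : 0 < p) (μ₁ : Measure α) (μ₂ : Measure δ)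
    [IsProbabilityMeasure μ₁] [IsProbabilityMeasure μ₂]
    (ν : Measure (Matrix.orthogonalGroup (Fin p) ℝ)) [IsProbabilityMeasure ν]
    [ν.IsMulRightInvariant] {β : α → δ → EuclideanSpace ℝ (Fin p)}
    {S : α → δ → Submodule ℝ (EuclideanSpace ℝ (Fin p))}
    (hS : ∀ a b, Module.finrank ℝ (S a b) ≤ n)
    (hA : MeasurableSet {q : α × δ × Matrix.orthogonalGroup (Fin p) ℝ | β q.1 q.2.1 ≠ 0 ∧
      4 * (n / p : ℝ) * ‖β q.1 q.2.1‖ ^ 2 ≤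
        ‖(S q.1 q.2.1).starProjection (orthogonalIsometry q.2.2 (β q.1 q.2.1))‖ ^ 2}) :
    μ₁.prod (μ₂.prod ν) {q : α × δ × Matrix.orthogonalGroup (Fin p) ℝ | β q.1 q.2.1 ≠ 0 ∧
      4 * (n / p : ℝ) * ‖β q.1 q.2.1‖ ^ 2 ≤
        ‖(S q.1 q.2.1).starProjection (orthogonalIsometry q.2.2 (β q.1 q.2.1))‖ ^ 2} ≤
      ENNReal.ofReal (Real.exp (-(n / 4))) := by
  refine measure_prod_prod_le_of_section_le _ _ _ hA fun a b => ?_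
  by_cases h0 : β a b = 0
  · simp [h0]
  · exact (measure_mono fun O hO => hO.2).trans (rotation_projection_le (hS a b) hn hp ν h0)

theorem prod_rotation_symm_projection_le {α δ : Type*} [MeasurableSpace α] [MeasurableSpace δ]
    {n p : ℕ} (hn : 17 * n ≤ p) (hp : 0 < p) (μ₁ : Measure α) (μ₂ : Measure δ)
    [IsProbabilityMeasure μ₁] [IsProbabilityMeasure μ₂]
    (ν : Measure (Matrix.orthogonalGroup (Fin p) ℝ)) [IsProbabilityMeasure ν]
    [ν.IsMulLeftInvariant] {β : α → δ → EuclideanSpace ℝ (Fin p)}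
    {S : α → δ → Submodule ℝ (EuclideanSpace ℝ (Fin p))}
    (hS : ∀ a b, Module.finrank ℝ (S a b) ≤ n)
    (hA : MeasurableSet {q : α × δ × Matrix.orthogonalGroup (Fin p) ℝ | β q.1 q.2.1 ≠ 0 ∧
      4 * (n / p : ℝ) * ‖β q.1 q.2.1‖ ^ 2 ≤
        ‖(S q.1 q.2.1).starProjection ((orthogonalIsometry q.2.2).symm (β q.1 q.2.1))‖ ^ 2}) :
    μ₁.prod (μ₂.prod ν) {q : α × δ × Matrix.orthogonalGroup (Fin p) ℝ | β q.1 q.2.1 ≠ 0 ∧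
      4 * (n / p : ℝ) * ‖β q.1 q.2.1‖ ^ 2 ≤
        ‖(S q.1 q.2.1).starProjection ((orthogonalIsometry q.2.2).symm (β q.1 q.2.1))‖ ^ 2} ≤
      ENNReal.ofReal (Real.exp (-(n / 4))) := by
  refine measure_prod_prod_le_of_section_le _ _ _ hA fun a b => ?_
  by_cases h0 : β a b = 0
  · simp [h0]
  · exact (measure_mono fun O hO => hO.2).trans (rotation_symm_projection_le (hS a b) hn hp ν h0)

/-- The minimum-norm interpolator of the data of task A, on the event where the rescaled residual
of `κ⁻¹ W θ` interpolates them. -/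
noncomputable def interpolatorA {n p d : ℕ} (W : Matrix (Fin p) (Fin d) ℝ) (κ : ℝ)
    (θ : EuclideanSpace ℝ (Fin d)) (Z : Fin n → EuclideanSpace ℝ (Fin d))
    (U : Fin n → EuclideanSpace ℝ (Fin p)) : EuclideanSpace ℝ (Fin p) :=
  -- Joining `⊥` gives the row space the form `span ⊔ V` of the measurability lemmas.
  (Submodule.span ℝ (Set.range fun i => observed W (Z i) (U i)) ⊔ ⊥).starProjection
    (rescaledResidual
      (Submodule.span ℝ (Set.range U) ⊔ (ℝ ∙ θ)ᗮ.map (Matrix.toEuclideanLin W))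
      (κ⁻¹ • Matrix.toEuclideanLin W θ))

theorem measurable_interpolatorA {α : Type*} [MeasurableSpace α] {n p d : ℕ}
    (W : Matrix (Fin p) (Fin d) ℝ) (κ : ℝ) (θ : EuclideanSpace ℝ (Fin d))
    {Z : α → Fin n → EuclideanSpace ℝ (Fin d)} {U : α → Fin n → EuclideanSpace ℝ (Fin p)}
    (hZ : Measurable Z) (hU : Measurable U) :
    Measurable fun a => interpolatorA W κ θ (Z a) (U a) :=
  measurable_starProjection_span_sup_comp ⊥
    (measurable_pi_iff.2 fun i => measurable_observed W
      ((measurable_pi_apply i).comp hZ) ((measurable_pi_apply i).comp hU))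
    (measurable_rescaledResidual _ hU _)

theorem exists_interpolators_of_good {n p d : ℕ} {W : Matrix (Fin p) (Fin d) ℝ} {κ : ℝ}
    (hκ : 0 < κ) (hW : Wᵀ * W = κ • (1 : Matrix (Fin d) (Fin d) ℝ)) (hn : 17 * n ≤ p)
    (hp : 0 < p) {θ : EuclideanSpace ℝ (Fin d)} {Z : Fin n → EuclideanSpace ℝ (Fin d)}
    {U : Fin n → EuclideanSpace ℝ (Fin p)} {O : Matrix.orthogonalGroup (Fin p) ℝ}
    (h₁ : 1 / 2 * ‖κ⁻¹ • Matrix.toEuclideanLin W θ‖ ^ 2 <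
      ‖κ⁻¹ • Matrix.toEuclideanLin W θ - (Submodule.span ℝ (Set.range U) ⊔
        (ℝ ∙ θ)ᗮ.map (Matrix.toEuclideanLin W)).starProjection
          (κ⁻¹ • Matrix.toEuclideanLin W θ)‖ ^ 2)
    (h₂ : ‖(Submodule.span ℝ (Set.range fun i => observed W (Z i) (U i)) ⊔ ⊥).starProjection
      ((orthogonalIsometry O).symm (interpolatorA W κ θ Z U))‖ ^ 2 ≤
      4 * (n / p : ℝ) * ‖interpolatorA W κ θ Z U‖ ^ 2)
    (h₃ : ‖(Matrix.toEuclideanLin W).range.starProjection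
      (orthogonalIsometry O (interpolatorA W κ θ Z U))‖ ^ 2 ≤
      4 * (n / p : ℝ) * ‖interpolatorA W κ θ Z U‖ ^ 2) :
    ∃ βA βBA : EuclideanSpace ℝ (Fin p),
      IsClosestInterpolator (dataA W Z U) (responses θ Z) 0 βA ∧
      IsClosestInterpolator (dataB W Z U O) (responses θ Z) βA βBA ∧
      risk W θ βBA - risk W θ βA ≤
        (66 * Real.sqrt ((n : ℝ) / (p : ℝ)) + 12 / κ) * ‖θ‖ ^ 2 := by
  have hL := inner_toEuclideanLin hW
  set L := Matrix.toEuclideanLin W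
  set r : Fin n → EuclideanSpace ℝ (Fin p) := fun i => observed W (Z i) (U i) with hr
  set R := Submodule.span ℝ (Set.range r) ⊔ ⊥ with hR
  have hrR : ∀ i, r i ∈ R := fun i =>
    Submodule.mem_sup_left (Submodule.subset_span ⟨i, rfl⟩)
  set b := rescaledResidual (Submodule.span ℝ (Set.range U) ⊔ (ℝ ∙ θ)ᗮ.map L) (κ⁻¹ • L θ)
  set β := interpolatorA W κ θ Z U with hβdef
  have hβb : β = R.starProjection b := rfl
  have hβR : β ∈ R := R.starProjection_apply_mem b
  have hadj : L.adjoint b = θ := adjoint_rescaledResidual hκ hL le_sup_right h₁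
  have hyb : ∀ i, inner ℝ (r i) b = responses θ Z i := by
    intro i
    have e : r i = L (Z i) + U i := rfl
    rw [e, inner_add_left, inner_rescaledResidual_of_mem _
      (Submodule.mem_sup_left (Submodule.subset_span (Set.mem_range_self i))),
      ← LinearMap.adjoint_inner_right, hadj, add_zero]
    rfl
  have hPinner : ∀ i x, inner ℝ (r i) (R.starProjection x) = inner ℝ (r i) x := by
    intro i x
    rw [← Submodule.inner_starProjection_left_eq_right,
      Submodule.starProjection_eq_self_iff.2 (hrR i)]
  have hy : ∀ i, inner ℝ (r i) β = responses θ Z i := fun i => by rw [hβb, hPinner, hyb]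
  have hnorm : κ * ‖β‖ ^ 2 ≤ 2 * ‖θ‖ ^ 2 := by
    have e1 : ‖β‖ ^ 2 ≤ ‖b‖ ^ 2 := by
      gcongr
      exact Submodule.norm_starProjection_apply_le R b
    have e2 := norm_rescaledResidual_sq_le h₁
    have e3 : ‖κ⁻¹ • L θ‖ ^ 2 = κ⁻¹ * ‖θ‖ ^ 2 := by
      rw [norm_smul, mul_pow, ← real_inner_self_eq_norm_sq (L θ), hL, real_inner_self_eq_norm_sq,
        Real.norm_of_nonneg (by positivity)]
      field_simp
    rw [e3] at e2
    calc κ * ‖β‖ ^ 2 ≤ κ * (2 * (κ⁻¹ * ‖θ‖ ^ 2)) := by gcongr; exact e1.trans e2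
      _ = 2 * ‖θ‖ ^ 2 := by field_simp
  set Q := orthogonalIsometry O
  have hp' : (0 : ℝ) < p := by exact_mod_cast hp
  have hs : Real.sqrt ((n : ℝ) / p) ≤ 1 / 4 := by
    rw [Real.sqrt_le_left (by norm_num), div_le_iff₀ hp']
    have : (17 * n : ℝ) ≤ p := by exact_mod_cast hn
    have : (0 : ℝ) ≤ n := by positivity
    linarith
  -- `Q β` interpolates task B, whose row space is `Q R`; the correction to `β` is the projection of
  -- `Q β - β` onto `Q R`.
  refine ⟨β, β + Q (R.starProjection (β - Q.symm β)), ?_, ?_, ?_⟩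
  · exact isClosestInterpolator_of_sub_mem_span hy (by simpa [hR] using hβR)
  · rw [dataB_eq]
    refine isClosestInterpolator_of_sub_mem_span (fun i => ?_) ?_
    · rw [inner_add_right]
      change inner ℝ (Q (r i)) β + inner ℝ (Q (r i)) (Q _) = _
      rw [Q.inner_map_map, hPinner, inner_sub_right, hy]
      have : inner ℝ (Q (r i)) β = inner ℝ (r i) (Q.symm β) := by
        rw [← Q.inner_map_map (r i), Q.apply_symm_apply]
      rw [this]
      ring
    · rw [add_sub_cancel_left]
      have h := Submodule.mem_map_of_mem (f := (Q.toLinearEquiv :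
        EuclideanSpace ℝ (Fin p) →ₗ[ℝ] EuclideanSpace ℝ (Fin p)))
        (R.starProjection_apply_mem (β - Q.symm β))
      have e := span_range_comp_sup Q r (V := ⊥) (by simp)
      rw [← e, sup_bot_eq] at h
      exact h
  · rw [risk_eq, risk_eq]
    have hs2 : Real.sqrt ((n : ℝ) / p) ^ 2 = n / p := Real.sq_sqrt (by positivity)
    exact risk_increase_le hκ (Real.sqrt_nonneg _) hs hL hβR hnorm Q (by rw [hs2]; exact h₂)
      (by rw [hs2]; exact h₃)

/-- For `θ = 0` the strict residual inequality fails (`w = 0`), but zero solves both problems. -/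
theorem exists_interpolators_of_eq_zero {n p d : ℕ} (W : Matrix (Fin p) (Fin d) ℝ)
    (Z : Fin n → EuclideanSpace ℝ (Fin d)) (U : Fin n → EuclideanSpace ℝ (Fin p))
    (O : Matrix.orthogonalGroup (Fin p) ℝ) (C : ℝ) :
    ∃ βA βBA : EuclideanSpace ℝ (Fin p),
      IsClosestInterpolator (dataA W Z U) (responses 0 Z) 0 βA ∧
      IsClosestInterpolator (dataB W Z U O) (responses 0 Z) βA βBA ∧
      risk W 0 βBA - risk W 0 βA ≤ C * ‖(0 : EuclideanSpace ℝ (Fin d))‖ ^ 2 := by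
  refine ⟨0, 0, isClosestInterpolator_of_sub_mem_span (fun i => ?_) (by simp), ?_, by simp⟩
  · simp [responses, response]
  · rw [dataB_eq]
    exact isClosestInterpolator_of_sub_mem_span (fun i => by simp [responses, response]) (by simp)

theorem exists_bad_set_measure_le {n p d : ℕ} {W : Matrix (Fin p) (Fin d) ℝ} {κ : ℝ}
    (hκ : 0 < κ) (hW : Wᵀ * W = κ • (1 : Matrix (Fin d) (Fin d) ℝ)) (hd : d ≤ n)
    (hn : 17 * n ≤ p) (hp : 0 < p) {θ : EuclideanSpace ℝ (Fin d)} (hθ : θ ≠ 0)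
    (haar : Measure (Matrix.orthogonalGroup (Fin p) ℝ)) [haar.IsHaarMeasure]
    [IsProbabilityMeasure haar] :
    ∃ B : Set ((Fin n → EuclideanSpace ℝ (Fin d)) × (Fin n → EuclideanSpace ℝ (Fin p)) ×
        Matrix.orthogonalGroup (Fin p) ℝ), MeasurableSet B ∧
      ((Measure.pi fun _ : Fin n => stdGaussian (EuclideanSpace ℝ (Fin d))).prod
        ((Measure.pi fun _ : Fin n => stdGaussian (EuclideanSpace ℝ (Fin p))).prod haar)) B ≤
        3 * ENNReal.ofReal (Real.exp (-(n / 4))) ∧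
      ∀ q ∉ B, ∃ βA βBA : EuclideanSpace ℝ (Fin p),
        IsClosestInterpolator (dataA W q.1 q.2.1) (responses θ q.1) 0 βA ∧
        IsClosestInterpolator (dataB W q.1 q.2.1 q.2.2) (responses θ q.1) βA βBA ∧
        risk W θ βBA - risk W θ βA ≤
          (66 * Real.sqrt ((n : ℝ) / (p : ℝ)) + 12 / κ) * ‖θ‖ ^ 2 := by
  have hL := inner_toEuclideanLin hW
  have := isMulRightInvariant_of_isHaarMeasure haar
  set L := Matrix.toEuclideanLin W with hLdef
  set V := (ℝ ∙ θ)ᗮ.map L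
  set w := κ⁻¹ • L θ
  have hV : Module.finrank ℝ V ≤ n := by
    refine (Submodule.finrank_map_le _ _).trans ((Submodule.finrank_le _).trans ?_)
    rwa [finrank_euclideanSpace_fin]
  have hrange : Module.finrank ℝ L.range ≤ n := by
    refine (LinearMap.finrank_range_le L).trans ?_
    rwa [finrank_euclideanSpace_fin]
  have hw : w ≠ 0 := by
    refine smul_ne_zero (inv_ne_zero hκ.ne') fun h => hθ ?_
    have e := hL θ θ
    rw [h, inner_zero_left, zero_eq_mul] at e
    exact inner_self_eq_zero.1 (e.resolve_left hκ.ne')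
  have hwV : w ∈ Vᗮ := by
    rintro _ ⟨y, hy, rfl⟩
    rw [inner_smul_right, hL, Submodule.mem_orthogonal_singleton_iff_inner_left.1 hy]
    simp
  have hZ : Measurable fun q : (Fin n → EuclideanSpace ℝ (Fin d)) × (Fin n → EuclideanSpace ℝ (Fin p)) ×
      Matrix.orthogonalGroup (Fin p) ℝ => q.1 := measurable_fst
  have hU : Measurable fun q : (Fin n → EuclideanSpace ℝ (Fin d)) × (Fin n → EuclideanSpace ℝ (Fin p)) ×
      Matrix.orthogonalGroup (Fin p) ℝ => q.2.1 :=
    measurable_fst.comp measurable_snd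
  have hO : Measurable fun q : (Fin n → EuclideanSpace ℝ (Fin d)) × (Fin n → EuclideanSpace ℝ (Fin p)) ×
      Matrix.orthogonalGroup (Fin p) ℝ => q.2.2 :=
    measurable_snd.comp measurable_snd
  have hβm := measurable_interpolatorA W κ θ hZ hU
  have hrows : Measurable fun q : (Fin n → EuclideanSpace ℝ (Fin d)) × (Fin n → EuclideanSpace ℝ (Fin p)) ×
      Matrix.orthogonalGroup (Fin p) ℝ =>
      fun i => observed W (q.1 i) (q.2.1 i) :=
    measurable_pi_iff.2 fun i => measurable_observed W
      ((measurable_pi_apply i).comp hZ) ((measurable_pi_apply i).comp hU)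
  have hrot := measurable_orthogonalIsometry_comp hO hβm
  have hrot' := measurable_orthogonalIsometry_comp hO.inv hβm
  simp only [Pi.inv_apply, ← symm_orthogonalIsometry] at hrot'
  let B₀ : Set (Fin n → EuclideanSpace ℝ (Fin p)) :=
    {u | ‖w - (Submodule.span ℝ (Set.range u) ⊔ V).starProjection w‖ ^ 2 ≤ 1 / 2 * ‖w‖ ^ 2}
  have hB₀ : MeasurableSet B₀ := measurableSet_le
    ((measurable_const.sub (measurable_starProjection_span_sup_comp V measurable_id
      measurable_const)).norm.pow_const 2) measurable_const
  let B₁ : Set ((Fin n → EuclideanSpace ℝ (Fin d)) × (Fin n → EuclideanSpace ℝ (Fin p)) ×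
    Matrix.orthogonalGroup (Fin p) ℝ) := {q | q.2.1 ∈ B₀}
  -- A vanishing interpolator is excluded from `B₂` and `B₃`: there the bad inequality is `0 ≤ 0`,
  -- yet the desired bound is trivial.
  let B₂ : Set ((Fin n → EuclideanSpace ℝ (Fin d)) × (Fin n → EuclideanSpace ℝ (Fin p)) ×
    Matrix.orthogonalGroup (Fin p) ℝ) := {q | interpolatorA W κ θ q.1 q.2.1 ≠ 0 ∧
      4 * (n / p : ℝ) * ‖interpolatorA W κ θ q.1 q.2.1‖ ^ 2 ≤
      ‖(Submodule.span ℝ (Set.range fun i => observed W (q.1 i) (q.2.1 i)) ⊔ ⊥).starProjection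
        ((orthogonalIsometry q.2.2).symm (interpolatorA W κ θ q.1 q.2.1))‖ ^ 2}
  let B₃ : Set ((Fin n → EuclideanSpace ℝ (Fin d)) × (Fin n → EuclideanSpace ℝ (Fin p)) ×
    Matrix.orthogonalGroup (Fin p) ℝ) := {q | interpolatorA W κ θ q.1 q.2.1 ≠ 0 ∧
      4 * (n / p : ℝ) * ‖interpolatorA W κ θ q.1 q.2.1‖ ^ 2 ≤
      ‖L.range.starProjection (orthogonalIsometry q.2.2 (interpolatorA W κ θ q.1 q.2.1))‖ ^ 2}
  have hne : MeasurableSet {q : (Fin n → EuclideanSpace ℝ (Fin d)) ×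
      (Fin n → EuclideanSpace ℝ (Fin p)) × Matrix.orthogonalGroup (Fin p) ℝ |
      interpolatorA W κ θ q.1 q.2.1 ≠ 0} :=
    (hβm (measurableSet_singleton 0)).compl
  have hlhs := (hβm.norm.pow_const 2).const_mul (4 * (n / p : ℝ))
  have hB₁ : MeasurableSet B₁ := hB₀.preimage hU
  have hB₂ : MeasurableSet B₂ := hne.inter (measurableSet_le hlhs
    ((measurable_starProjection_span_sup_comp ⊥ hrows hrot').norm.pow_const 2))
  have hB₃ : MeasurableSet B₃ := hne.inter (measurableSet_le hlhs
    ((L.range.starProjection.continuous.measurable.comp hrot).norm.pow_const 2))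
  refine ⟨B₁ ∪ B₂ ∪ B₃, (hB₁.union hB₂).union hB₃, ?_, ?_⟩
  · have m₁ : ((Measure.pi fun _ : Fin n => stdGaussian (EuclideanSpace ℝ (Fin d))).prod
        ((Measure.pi fun _ : Fin n => stdGaussian (EuclideanSpace ℝ (Fin p))).prod haar)) B₁ ≤
        ENNReal.ofReal (Real.exp (-(n / 4))) := by
      have e := (measurePreserving_fst.comp measurePreserving_snd :
        MeasurePreserving _ ((Measure.pi fun _ : Fin n =>
          stdGaussian (EuclideanSpace ℝ (Fin d))).prod ((Measure.pi fun _ : Fin n =>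
            stdGaussian (EuclideanSpace ℝ (Fin p))).prod haar)) _).measure_preimage
              hB₀.nullMeasurableSet
      exact e.trans_le <| pi_stdGaussian_residual_le hV (by rwa [finrank_euclideanSpace_fin]) hw hwV
    have m₂ : ((Measure.pi fun _ : Fin n => stdGaussian (EuclideanSpace ℝ (Fin d))).prod
        ((Measure.pi fun _ : Fin n => stdGaussian (EuclideanSpace ℝ (Fin p))).prod haar)) B₂ ≤
        ENNReal.ofReal (Real.exp (-(n / 4))) := by
      refine prod_rotation_symm_projection_le (β := interpolatorA W κ θ)
        (S := fun z u => Submodule.span ℝ (Set.range fun i => observed W (z i) (u i)) ⊔ ⊥)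
        hn hp _ _ haar (fun z u => ?_) hB₂
      simpa using finrank_span_sup_le (fun i => observed W (z i) (u i)) ⊥
    have m₃ : ((Measure.pi fun _ : Fin n => stdGaussian (EuclideanSpace ℝ (Fin d))).prod
        ((Measure.pi fun _ : Fin n => stdGaussian (EuclideanSpace ℝ (Fin p))).prod haar)) B₃ ≤
        ENNReal.ofReal (Real.exp (-(n / 4))) :=
      prod_rotation_projection_le (β := interpolatorA W κ θ) (S := fun _ _ => L.range)
        hn hp _ _ haar (fun _ _ => hrange) hB₃
    refine (measure_union_le _ _).trans ((add_le_add ((measure_union_le _ _).trans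
      (add_le_add m₁ m₂)) m₃).trans_eq ?_)
    ring
  · intro q hq
    simp only [Set.mem_union, not_or] at hq
    obtain ⟨⟨q₁, q₂⟩, q₃⟩ := hq
    refine exists_interpolators_of_good hκ hW hn hp (not_le.1 q₁) ?_ ?_
    · by_cases h0 : interpolatorA W κ θ q.1 q.2.1 = 0
      · simp [h0]
      · exact (not_le.1 fun h => q₂ ⟨h0, h⟩).le
    · by_cases h0 : interpolatorA W κ θ q.1 q.2.1 = 0
      · simp [h0]
      · exact (not_le.1 fun h => q₃ ⟨h0, h⟩).le

end LatentRegression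

theorem theorem1 :
    ∃ c : ℝ, 0 < c ∧
      ∀ (d n p : ℕ) (γ : ℝ) (θ : EuclideanSpace ℝ (Fin d)) (W : Matrix (Fin p) (Fin d) ℝ),
        0 < γ →
        Wᵀ * W = ((p : ℝ) * γ) • (1 : Matrix (Fin d) (Fin d) ℝ) →
        d ≤ n →
        max (17 * (n : ℝ)) (1 / γ) ≤ (p : ℝ) →
        ∀ {Ω : Type*} [MeasurableSpace Ω] (μ : Measure Ω) [IsProbabilityMeasure μ]
          (Z : Ω → Fin n → EuclideanSpace ℝ (Fin d))
          (U : Ω → Fin n → EuclideanSpace ℝ (Fin p))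
          (O : Ω → Matrix.orthogonalGroup (Fin p) ℝ)
          (haar : Measure (Matrix.orthogonalGroup (Fin p) ℝ))
          [haar.IsHaarMeasure] [IsProbabilityMeasure haar],
          -- all `zᵢ ~ N(0, I_d)`, all `uᵢ ~ N(0, I_p)` and the Haar matrix `O` are independent
          HasLaw (fun ω => (Z ω, U ω, O ω))
            ((Measure.pi fun _ : Fin n => stdGaussian (EuclideanSpace ℝ (Fin d))).prod
              ((Measure.pi fun _ : Fin n => stdGaussian (EuclideanSpace ℝ (Fin p))).prod haar)) μ →
          1 - 10 * Real.exp (-c * (d : ℝ)) ≤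
            μ.real {ω | ∃ βA βBA : EuclideanSpace ℝ (Fin p),
              LatentRegression.IsClosestInterpolator
                (LatentRegression.dataA W (Z ω) (U ω)) (LatentRegression.responses θ (Z ω))
                0 βA ∧
              LatentRegression.IsClosestInterpolator
                (LatentRegression.dataB W (Z ω) (U ω) (O ω)) (LatentRegression.responses θ (Z ω))
                βA βBA ∧
              LatentRegression.risk W θ βBA - LatentRegression.risk W θ βA ≤
                (66 * Real.sqrt ((n : ℝ) / (p : ℝ)) + 12 / ((p : ℝ) * γ)) * ‖θ‖ ^ 2} := by
  -- Each of the three bad events costs `exp (-n/4) ≤ exp (-d/4)`, and `3 ≤ 10`.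
  refine ⟨1 / 4, by norm_num, ?_⟩
  intro d n p γ θ W hγ hW hdn hp Ω _ μ _ Z U O haar _ _ hlaw
  have hp₁ : 0 < (p : ℝ) := (one_div_pos.2 hγ).trans_le ((le_max_right _ _).trans hp)
  have hp₀ : 0 < p := by exact_mod_cast hp₁
  have hn : 17 * n ≤ p := by exact_mod_cast (le_max_left _ _).trans hp
  by_cases hθ : θ = 0
  · subst hθ
    simp only [LatentRegression.exists_interpolators_of_eq_zero, Set.ofPred_true, probReal_univ]
    have := Real.exp_pos (-(1 / 4) * (d : ℝ))
    linarith
  obtain ⟨B, hB, hBle, hgood⟩ :=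
    LatentRegression.exists_bad_set_measure_le (mul_pos hp₁ hγ) hW hdn hn hp₀ hθ haar
  have hbad : μ.real ((fun ω => (Z ω, U ω, O ω)) ⁻¹' B) ≤ 3 * Real.exp (-(n / 4)) := by
    rw [← hlaw.map_eq, Measure.map_apply_of_aemeasurable hlaw.aemeasurable hB] at hBle
    refine ENNReal.toReal_le_of_le_ofReal (by positivity) (hBle.trans_eq ?_)
    rw [ENNReal.ofReal_mul (by norm_num), ENNReal.ofReal_ofNat]
  have hexp : Real.exp (-((n : ℝ) / 4)) ≤ Real.exp (-(1 / 4) * d) := by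
    have : (d : ℝ) ≤ n := by exact_mod_cast hdn
    exact Real.exp_le_exp.2 (by linarith)
  have hpos := Real.exp_pos (-(1 / 4) * (d : ℝ))
  have hcover : 1 ≤ μ.real {ω | ∃ βA βBA : EuclideanSpace ℝ (Fin p),
      LatentRegression.IsClosestInterpolator
        (LatentRegression.dataA W (Z ω) (U ω)) (LatentRegression.responses θ (Z ω)) 0 βA ∧
      LatentRegression.IsClosestInterpolator
        (LatentRegression.dataB W (Z ω) (U ω) (O ω)) (LatentRegression.responses θ (Z ω)) βA βBA ∧
      LatentRegression.risk W θ βBA - LatentRegression.risk W θ βA ≤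
        (66 * Real.sqrt ((n : ℝ) / (p : ℝ)) + 12 / ((p : ℝ) * γ)) * ‖θ‖ ^ 2} +
      μ.real ((fun ω => (Z ω, U ω, O ω)) ⁻¹' B) := by
    refine le_trans ?_ (measureReal_union_le _ _)
    rw [← probReal_univ (μ := μ)]
    refine measureReal_mono fun ω _ => ?_
    by_cases hω : (Z ω, U ω, O ω) ∈ B
    · exact Or.inr hω
    · exact Or.inl (hgood _ hω)
  linarith
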